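/- Let $N,s,q,m$ be nonnegative integers. Let $\Theta\subset\mathbb R^m$ and, for each $\theta\in\Theta$, let $\mathbf g(\cdot;\theta)=(g_1,\dots,g_N)(\cdot;\theta)$ be a map from $[0,1]^{Ns}\times\{0,1\}^{Nq}$ to $[0,1]^N$. Let $\theta_0\in\Theta$ and let $(\mathbf y_t,\mathbf p_t)_{t\in\mathbb Z}$, with $\mathbf y_t\in\{0,1\}^N$ and $\mathbf p_t\in[0,1]^N$, be a process on a probability space such that for every $t\in\mathbb Z$, conditionally on $\mathcal I_{t-1}=\sigma(\mathbf y_\tau,\tau\le t-1)$, the components $y_{1,t},\dots,y_{N,t}$ are independent and $y_{i,t}$ is Bernoulli with success probability $p_{i,t}$, and almost surely $$\mathbf p_t=\mathbf g\big(\mathbf p_{t-1},\dots,\mathbf p_{t-s},\mathbf y_{t-1},\dots,\mathbf y_{t-q};\theta_0\big).$$ Assume: 1. $\Theta$ is compact. 2. $(\mathbf P,\mathbf Y,\theta)\mapsto\mathbf g(\mathbf P,\mathbf Y;\theta)$ is continuous on $[0,1]^{Ns}\times\{0,1\}^{Nq}\times\Theta$. 3. There is $\varepsilon>0$ such that $g_i(\cdot;\theta)\in[\varepsilon,1-\varepsilon]$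 for all $i$ and all $\theta\in\Theta$. 4. If $\theta\in\Theta$ and, for all $t$, almost surely $\mathbf g(\mathbf p_{t-1},\dots,\mathbf p_{t-s},\mathbf y_{t-1},\dots,\mathbf y_{t-q};\theta)=\mathbf g(\mathbf p_{t-1},\dots,\mathbf p_{t-s},\mathbf y_{t-1},\dots,\mathbf y_{t-q};\theta_0)$, then $\theta=\theta_0$. 5. Either (a) for every $\theta\in\Theta$, or (b) for every $\theta\in\Theta$, the following holds, where $\mathbf P=(P_{j,\tau})_{j\le N,\tau\le s}$, $\mathbf P'$ range over $[0,1]^{Ns}$ and $\mathbf Y=(Y_{j,\tau})_{j\le N,\tau\le q}$, $\mathbf Y'$ range over $\{0,1\}^{Nq}$: (a) There are coefficients $\alpha_{ij}^\tau,\beta_{ij}^\tau\ge0$ (which may depend on $\theta$), with $\alpha_{ij}^\tau=0$ for $\tau>q$ and $\beta_{ij}^\tau=0$ for $\tau>s$, such that for all $i$ $$|g_i(\mathbf P,\mathbf Y;\theta)-g_i(\mathbf P',\mathbf Y';\theta)|\le\sum_{j=1}^N\sum_{\tau=1}^s\beta_{ij}^\tau|P_{j,\tau}-P'_{j,\tau}|+\sum_{j=1}^N\sum_{\tau=1}^q\alpha_{ij}^\tau|Y_{j,\tau}-Y'_{j,\tau}|,$$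 and the $N\max(s,q)\times N\max(s,q)$ companion matrix whose first block row is $(\alpha^1+\beta^1,\dots,\alpha^{\max(s,q)}+\beta^{\max(s,q)})$, with $N\times N$ identity blocks on the first block subdiagonal and zeros elsewhere, has spectral radius less than $1$. (b) There is $K\ge0$ (which may depend on $\theta$) with $K(s+q)<1$ such that $$\sum_{i=1}^N|g_i(\mathbf P,\mathbf Y;\theta)-g_i(\mathbf P',\mathbf Y';\theta)|\le K\Big(\sum_{i=1}^N\sum_{\tau=1}^s|P_{i,\tau}-P'_{i,\tau}|+\sum_{i=1}^N\sum_{\tau=1}^q|Y_{i,\tau}-Y'_{i,\tau}|\Big).$$ For each sample size $T$ let the likelihood be initialized with arbitrary, possibly random and $T$-dependent, values $\mathbf p_0(\theta),\dots,\mathbf p_{-s+1}(\theta)\in[0,1]^N$ that do not depend on $\theta$ (for instance the true $\mathbf p_0,\dots,\mathbf p_{-s+1}$, constants, or sample means of $\mathbf y_t$). For $t\ge1$ put recursively $\mathbf p_t(\theta)=\mathbf g(\mathbf p_{t-1}(\theta),\dots,\mathbf p_{t-s}(\theta),\mathbf y_{t-1},\dots,\mathbf y_{t-q};\theta)$, and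 let $$\mathcal Q_T(\theta)=\sum_{t=1}^T\sum_{i=1}^N\Big[y_{i,t}\log p_{i,t}(\theta)+(1-y_{i,t})\log\big(1-p_{i,t}(\theta)\big)\Big].$$ Let $\hat\theta_T\in\Theta$ be almost surely a maximizer of $\mathcal Q_T$ over $\Theta$, for each $T$. Then $\hat\theta_T\to\theta_0$ in probability as $T\to\infty$. -/

import Mathlib

open MeasureTheory Filter Topology

noncomputable section

namespace GAB

/-- The numerical value in `{0, 1}` of a binary outcome. -/
def val (b : Bool) : ℝ := if b then 1 else 0

/-- A probability update function `[0,1]^{Ns} × {0,1}^{Nq} → [0,1]^N`. In both arguments the index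
`k` stands for the lag `τ = k + 1`, so that `P k = p_{t-1-k}` and `Y k = y_{t-1-k}`. -/
abbrev UpdateMap (N s q : ℕ) : Type :=
  (Fin s → Fin N → unitInterval) → (Fin q → Fin N → Bool) → (Fin N → unitInterval)

/-- The information `I_t = σ(y_τ, τ ≤ t)`. -/
abbrev past {Ω : Type*} {N : ℕ} (y : ℤ → Ω → Fin N → Bool) (t : ℤ) : MeasurableSpace Ω :=
  ⨆ τ : ℤ, ⨆ _ : τ ≤ t, MeasurableSpace.comap (y τ) inferInstance

/-- The pair `(y, p)` is a generalized autoregressive binary process with update function `g`: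
conditionally on `I_{t-1}` the components of `y_t` are independent Bernoulli variables with success
probabilities `p_{i,t}`, and `p_t = g(p_{t-1}, …, p_{t-s}, y_{t-1}, …, y_{t-q})`, for all `t ∈ ℤ`. -/
structure IsProcess {Ω : Type*} [MeasurableSpace Ω] (μ : Measure Ω) {N s q : ℕ}
    (g : UpdateMap N s q) (y : ℤ → Ω → Fin N → Bool) (p : ℤ → Ω → Fin N → unitInterval) :
    Prop where
  measurable_y : ∀ t, Measurable (y t)
  measurable_p : ∀ t, Measurable (p t)
  condLaw : ∀ (t : ℤ) (v : Fin N → Bool),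
    μ[Set.indicator {ω | y t ω = v} (fun _ => (1 : ℝ)) | past y (t - 1)]
      =ᵐ[μ] fun ω => ∏ i, if v i then (p t ω i : ℝ) else 1 - (p t ω i : ℝ)
  update : ∀ t : ℤ, ∀ᵐ ω ∂μ,
    p t ω = g (fun k => p (t - 1 - (k : ℤ)) ω) (fun k => y (t - 1 - (k : ℤ)) ω)

/-- The companion matrix of the coefficients `α i j k`, `β i j k` (`k` stands for the lag `k + 1`),
with `M` block rows and block columns of size `N`: the first block row is
`(α^1 + β^1, …, α^M + β^M)`, and below it are identity blocks on the first block subdiagonal. -/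
def companion {N : ℕ} (M : ℕ) (α β : Fin N → Fin N → ℕ → ℝ) :
    Matrix (Fin M × Fin N) (Fin M × Fin N) ℝ :=
  fun r c =>
    if (r.1 : ℕ) = 0 then α r.2 c.2 c.1 + β r.2 c.2 c.1
    else if (r.1 : ℕ) = (c.1 : ℕ) + 1 ∧ r.2 = c.2 then 1 else 0

/-- Contraction through a stable companion matrix (spectral radius less than one). -/
def CompanionContraction {N s q : ℕ} (g : UpdateMap N s q) : Prop :=
  ∃ α β : Fin N → Fin N → ℕ → ℝ,
    (∀ i j k, 0 ≤ α i j k) ∧ (∀ i j k, 0 ≤ β i j k) ∧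
    (∀ i j k, q ≤ k → α i j k = 0) ∧ (∀ i j k, s ≤ k → β i j k = 0) ∧
    (∀ (P P' : Fin s → Fin N → unitInterval) (Y Y' : Fin q → Fin N → Bool) (i : Fin N),
      |(g P Y i : ℝ) - (g P' Y' i : ℝ)| ≤
        (∑ j, ∑ k : Fin s, |(P k j : ℝ) - (P' k j : ℝ)| * β i j k) +
        ∑ j, ∑ k : Fin q, |val (Y k j) - val (Y' k j)| * α i j k) ∧
    spectralRadius ℂ ((companion (max s q) α β).map (fun x : ℝ => (x : ℂ))) < 1

/-- Contraction in aggregate form, with a constant `0 ≤ K < 1 / (s + q)`. -/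
def AggregateContraction {N s q : ℕ} (g : UpdateMap N s q) : Prop :=
  ∃ K : ℝ, 0 ≤ K ∧ K * ((s : ℝ) + (q : ℝ)) < 1 ∧
    ∀ (P P' : Fin s → Fin N → unitInterval) (Y Y' : Fin q → Fin N → Bool),
      (∑ i, |(g P Y i : ℝ) - (g P' Y' i : ℝ)|) ≤
        K * ((∑ i, ∑ k : Fin s, |(P k i : ℝ) - (P' k i : ℝ)|) +
          ∑ i, ∑ k : Fin q, |val (Y k i) - val (Y' k i)|)

/-- The probabilities `(p_t, p_{t-1}, …, p_{t-s+1})` obtained by running the recursion of `g` along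
the observed outcomes `y`, from the initial values `init = (p_0, p_{-1}, …, p_{-s+1})`. -/
def fitted {N s q : ℕ} (g : UpdateMap N s q) (y : ℤ → Fin N → Bool)
    (init : Fin s → Fin N → unitInterval) : ℕ → Fin s → Fin N → unitInterval
  | 0 => init
  | t + 1 => fun k =>
      if (k : ℕ) = 0 then g (fitted g y init t) (fun j => y ((t : ℤ) - (j : ℤ)))
      else fitted g y init t ⟨(k : ℕ) - 1, by omega⟩

/-- The fitted success probability
`p_{t+1} = g(p_t, …, p_{t-s+1}, y_t, …, y_{t-q+1})` at time `t + 1`. -/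
def fittedNext {N s q : ℕ} (g : UpdateMap N s q) (y : ℤ → Fin N → Bool)
    (init : Fin s → Fin N → unitInterval) (t : ℕ) : Fin N → unitInterval :=
  g (fitted g y init t) (fun j => y ((t : ℤ) - (j : ℤ)))

/-- The log-likelihood of `y_1, …, y_T` under the update function `g`, conditional on the initial
values `y_0, …, y_{-q+1}` and `init = (p_0, …, p_{-s+1})`. The summand `t` belongs to the
time `t + 1`. -/
def logLikelihood {N s q : ℕ} (g : UpdateMap N s q) (y : ℤ → Fin N → Bool)
    (init : Fin s → Fin N → unitInterval) (T : ℕ) : ℝ :=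
  ∑ t ∈ Finset.range T, ∑ i,
    (val (y ((t : ℤ) + 1) i) * Real.log (fittedNext g y init t i : ℝ) +
      (1 - val (y ((t : ℤ) + 1) i)) * Real.log (1 - (fittedNext g y init t i : ℝ)))

end GAB

end

/-! Neither stationarity nor an ergodic theorem is needed: all randomness is handled by a weak law
for bounded martingale differences, and the rest is deterministic and uniform in the outcomes.

Both contraction conditions yield a gauge, equivalent to the sup distance, in which `P ↦ g P Y`
contracts the maximum over the lags (`IsContraction`). Hence an exact and an approximate solution
driven by the same outcomes end up close whatever their initial values (`IsContraction.forgetting`).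
For θ near θ₁ the θ-path approximately solves the θ₁-recursion, so likelihoods at θ and θ₁, with any
two initialisations, differ by at most δT + C (`exists_nhds_logLikelihood_sub_le`).

For θ₁ ≠ θ₀ the likelihood of the true probabilities wins by a multiple of T
(`IsProcess.exists_logScore_gap`). The score difference is a martingale difference plus a relative
entropy, which is at least a quarter of the squared distance between true and fitted probabilities.
This distance is not small too often: identification supplies one sample point and one time at which
the two updates differ; by forgetting, they differ by a fixed amount whenever the recent outcomes
repeat that sample point's outcomes over a long enough window; and since every outcome has
conditional probability at least ε^N, such a window recurs with positive frequency
(`IsProcess.exists_pattern_frequency`).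

The gap at θ₁ thus extends to a neighbourhood of θ₁, and finitely many such neighbourhoods cover the
part of Θ away from θ₀. -/

namespace GAB

/-! ### Nonnegative matrices with spectral radius less than one -/

section Perron

attribute [local instance] Matrix.linftyOpNormedRing Matrix.linftyOpNormedAlgebra

/-- A nonnegative matrix of spectral radius less than one has a positive strict supersolution. -/
theorem exists_one_le_mulVec_add_one_eq {ι : Type*} [Fintype ι] [DecidableEq ι]
    (A : Matrix ι ι ℝ) (hA : ∀ i j, 0 ≤ A i j)
    (hr : spectralRadius ℂ (A.map (fun x : ℝ => (x : ℂ))) < 1) :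
    ∃ w : ι → ℝ, (∀ i, 1 ≤ w i) ∧ ∀ i, (∑ j, A i j * w j) + 1 = w i := by
  set B : Matrix ι ι ℂ := A.map (fun x : ℝ => (x : ℂ)) with hB
  have hpow : ∀ n : ℕ, B ^ n = (A ^ n).map (fun x : ℝ => (x : ℂ)) := fun n =>
    (Matrix.map_pow A Complex.ofRealHom n).symm
  have hnn : ∀ (n : ℕ) i j, 0 ≤ (A ^ n) i j := by
    intro n
    induction n with
    | zero => intro i j; rw [pow_zero, Matrix.one_apply]; split_ifs <;> norm_num
    | succ n ih =>
      intro i j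
      rw [pow_succ, Matrix.mul_apply]
      exact Finset.sum_nonneg fun k _ => mul_nonneg (ih i k) (hA k j)
  obtain ⟨r, hr1, hr2⟩ := exists_between hr
  lift r to NNReal using (hr2.trans ENNReal.one_lt_top).ne
  have hr2' : r < 1 := by exact_mod_cast hr2
  -- Gelfand's formula: the powers decay geometrically. The norm is the row-sum operator norm, so it
  -- also bounds the row sums of `A ^ n` below.
  have hev : ∀ᶠ n : ℕ in atTop, ‖B ^ n‖ ≤ (r : ℝ) ^ n := by
    filter_upwards [(spectrum.pow_nnnorm_pow_one_div_tendsto_nhds_spectralRadius B).eventually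
      (gt_mem_nhds hr1), eventually_gt_atTop 0] with n hn hn0
    have h1 : (‖B ^ n‖₊ : ENNReal) ≤ (r : ENNReal) ^ n := by
      rw [one_div] at hn
      have := (ENNReal.rpow_inv_le_iff (by exact_mod_cast hn0 : (0 : ℝ) < n)).1 hn.le
      simpa using this
    exact_mod_cast h1
  have hsumB : Summable fun n : ℕ => ‖B ^ n‖ := by
    refine Summable.of_norm_bounded_eventually_nat
      (summable_geometric_of_lt_one r.coe_nonneg (by exact_mod_cast hr2')) ?_
    filter_upwards [hev] with n hn
    simpa using hn
  have hle : ∀ (n : ℕ) i, ∑ j, (A ^ n) i j ≤ ‖B ^ n‖ := by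
    intro n i
    have h1 : ∑ j, (A ^ n) i j = ((∑ j, ‖(B ^ n) i j‖₊ : NNReal) : ℝ) := by
      push_cast
      refine Finset.sum_congr rfl fun j _ => ?_
      rw [hpow, Matrix.map_apply, Complex.norm_real, Real.norm_eq_abs, abs_of_nonneg (hnn n i j)]
    rw [h1, Matrix.linfty_opNorm_def]
    exact_mod_cast Finset.le_sup (f := fun i => ∑ j, ‖(B ^ n) i j‖₊) (Finset.mem_univ i)
  have hsum : ∀ i, Summable fun n : ℕ => ∑ j, (A ^ n) i j := fun i =>
    Summable.of_nonneg_of_le (fun n => Finset.sum_nonneg fun j _ => hnn n i j) (hle · i) hsumB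
  -- The witness is the Neumann series w = ∑ Aⁿ1; splitting off n = 0 gives w = Aw + 1.
  have hrec : ∀ i, (∑ j, A i j * ∑' n : ℕ, ∑ k, (A ^ n) j k) + 1 =
      ∑' n : ℕ, ∑ k, (A ^ n) i k := by
    intro i
    rw [(hsum i).tsum_eq_zero_add, add_comm]
    congr 1
    · simp [Matrix.one_apply]
    · simp_rw [← tsum_mul_left]
      rw [← Summable.tsum_finsetSum fun j _ => (hsum j).mul_left _]
      refine tsum_congr fun n => ?_
      simp_rw [pow_succ', Matrix.mul_apply, Finset.mul_sum]
      exact Finset.sum_comm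
  refine ⟨fun i => ∑' n : ℕ, ∑ k, (A ^ n) i k, fun i => ?_, hrec⟩
  have h1 := hrec i
  have h2 : 0 ≤ ∑ j, A i j * ∑' n : ℕ, ∑ k, (A ^ n) j k :=
    Finset.sum_nonneg fun j _ => mul_nonneg (hA i j)
      (tsum_nonneg fun n => Finset.sum_nonneg fun k _ => hnn n j k)
  show 1 ≤ ∑' n : ℕ, ∑ k, (A ^ n) i k
  linarith

end Perron

/-! ### Contraction with respect to an equivalent gauge -/

/-- The map `P ↦ g P Y` contracts, uniformly in `Y`, the maximum over the lags of a gauge `d` that is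
equivalent to the distance. -/
def IsContraction {N s q : ℕ} (g : UpdateMap N s q) : Prop :=
  ∃ (d : (Fin N → unitInterval) → (Fin N → unitInterval) → ℝ) (C κ : ℝ),
    0 < C ∧ 0 ≤ κ ∧ κ < 1 ∧ (∀ x y z, d x z ≤ d x y + d y z) ∧ (∀ x y, d x y ≤ C * dist x y) ∧
    (∀ x y, dist x y ≤ C * d x y) ∧
    ∀ P P' Y R, 0 ≤ R → (∀ k, d (P k) (P' k) ≤ R) → d (g P Y) (g P' Y) ≤ κ * R

theorem coord_abs_sub_le_dist {N : ℕ} (x y : Fin N → unitInterval) (i : Fin N) :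
    |(x i : ℝ) - (y i : ℝ)| ≤ dist x y := by
  have := dist_le_pi_dist x y i
  rwa [Subtype.dist_eq, Real.dist_eq] at this

theorem dist_le_of_coord {N : ℕ} {x y : Fin N → unitInterval} {r : ℝ} (hr : 0 ≤ r)
    (h : ∀ i, |(x i : ℝ) - (y i : ℝ)| ≤ r) : dist x y ≤ r := by
  refine (dist_pi_le_iff hr).2 fun i => ?_
  rw [Subtype.dist_eq, Real.dist_eq]
  exact h i

theorem dist_le_one {N : ℕ} (x y : Fin N → unitInterval) : dist x y ≤ 1 := by
  refine dist_le_of_coord zero_le_one fun i => abs_le.2 ⟨?_, ?_⟩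
  · linarith [(x i).2.1, (y i).2.2]
  · linarith [(x i).2.2, (y i).2.1]

/-- The ℓ¹ distance is the gauge. With equal outcomes only the s lags of the probabilities
contribute, so the factor is K·s. The constant is N + 1 so as to be positive when N = 0. -/
theorem AggregateContraction.isContraction {N s q : ℕ} {g : UpdateMap N s q}
    (h : AggregateContraction g) : IsContraction g := by
  obtain ⟨K, hK, hK1, hg⟩ := h
  refine ⟨fun x y => ∑ i, |(x i : ℝ) - (y i : ℝ)|, N + 1, K * s, by positivity, by positivity,
    ?_, ?_, ?_, ?_, ?_⟩
  · have : 0 ≤ K * (q : ℝ) := by positivity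
    linarith
  · intro x y z
    rw [← Finset.sum_add_distrib]
    exact Finset.sum_le_sum fun i _ => abs_sub_le _ _ _
  · intro x y
    have h1 : ∑ i, |(x i : ℝ) - (y i : ℝ)| ≤ ∑ _i : Fin N, dist x y :=
      Finset.sum_le_sum fun i _ => coord_abs_sub_le_dist x y i
    have h2 : ∑ _i : Fin N, dist x y = N * dist x y := by simp
    have := dist_nonneg (x := x) (y := y)
    show ∑ i, |(x i : ℝ) - (y i : ℝ)| ≤ _
    linarith
  · intro x y
    have h0 : 0 ≤ ∑ i, |(x i : ℝ) - (y i : ℝ)| := Finset.sum_nonneg fun i _ => abs_nonneg _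
    have h1 : dist x y ≤ ∑ i, |(x i : ℝ) - (y i : ℝ)| := dist_le_of_coord h0 fun i =>
      Finset.single_le_sum (f := fun i => |(x i : ℝ) - (y i : ℝ)|) (fun _ _ => abs_nonneg _)
        (Finset.mem_univ i)
    refine h1.trans ?_
    show _ ≤ ((N : ℝ) + 1) * ∑ i, |(x i : ℝ) - (y i : ℝ)|
    have : 0 ≤ (N : ℝ) * ∑ i, |(x i : ℝ) - (y i : ℝ)| := by positivity
    linarith
  · intro P P' Y R hR hP
    refine (hg P P' Y Y).trans ?_
    simp only [sub_self, abs_zero, Finset.sum_const_zero, add_zero]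
    rw [Finset.sum_comm, mul_assoc]
    refine mul_le_mul_of_nonneg_left ?_ hK
    refine (Finset.sum_le_sum fun k _ => hP k).trans ?_
    simp

/-- The identity blocks force a supersolution of the companion matrix to increase with the lag. The
weights of all lags therefore dominate those of the first block, which can replace them in the first
block row; dropping α only weakens the sum. -/
theorem exists_weights_of_companion {N s M : ℕ} {α β : Fin N → Fin N → ℕ → ℝ} (hsM : s ≤ M)
    (hM : 0 < M) (hα : ∀ i j k, 0 ≤ α i j k) (hβ : ∀ i j k, 0 ≤ β i j k)
    (hr : spectralRadius ℂ ((companion M α β).map (fun x : ℝ => (x : ℂ))) < 1) :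
    ∃ w : Fin N → ℝ, (∀ i, 1 ≤ w i) ∧ ∀ i, (∑ j, ∑ k : Fin s, w j * β i j k) + 1 ≤ w i := by
  have hA : ∀ i j, 0 ≤ companion M α β i j := by
    intro i j
    unfold companion
    split_ifs
    · exact add_nonneg (hα _ _ _) (hβ _ _ _)
    · exact zero_le_one
    · exact le_rfl
  obtain ⟨w, hw1, hw⟩ := exists_one_le_mulVec_add_one_eq _ hA hr
  have hmono : ∀ (k : ℕ) (hk : k < M) i, w (⟨0, hM⟩, i) ≤ w (⟨k, hk⟩, i) := by
    intro k
    induction k with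
    | zero => exact fun _ _ => le_rfl
    | succ k ih =>
      intro hk i
      refine (ih (by omega) i).trans ?_
      have h1 := hw (⟨k + 1, hk⟩, i)
      have h2 : companion M α β (⟨k + 1, hk⟩, i) (⟨k, by omega⟩, i) * w (⟨k, by omega⟩, i) ≤
          ∑ j, companion M α β (⟨k + 1, hk⟩, i) j * w j :=
        Finset.single_le_sum (f := fun j => companion M α β (⟨k + 1, hk⟩, i) j * w j)
          (fun j _ => mul_nonneg (hA _ _) (zero_le_one.trans (hw1 j))) (Finset.mem_univ _)
      have h3 : companion M α β (⟨k + 1, hk⟩, i) (⟨k, by omega⟩, i) = 1 := by simp [companion]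
      rw [h3, one_mul] at h2
      linarith
  refine ⟨fun i => w (⟨0, hM⟩, i), fun i => hw1 _, fun i => ?_⟩
  have h1 := hw (⟨0, hM⟩, i)
  have h2 : ∑ k : Fin s, ∑ j, w (⟨0, hM⟩, j) * β i j k ≤
      ∑ k : Fin s, ∑ j, companion M α β (⟨0, hM⟩, i) (Fin.castLE hsM k, j) *
        w (Fin.castLE hsM k, j) := by
    refine Finset.sum_le_sum fun k _ => Finset.sum_le_sum fun j _ => ?_
    have h3 : companion M α β (⟨0, hM⟩, i) (Fin.castLE hsM k, j) = α i j k + β i j k := by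
      simp [companion]
    rw [h3, mul_comm]
    have h4 := hmono (Fin.castLE hsM k) (Fin.castLE hsM k).2 j
    have h5 := zero_le_one.trans (hw1 (⟨0, hM⟩, j))
    exact mul_le_mul (le_add_of_nonneg_left (hα _ _ _)) h4 h5 (add_nonneg (hα _ _ _) (hβ _ _ _))
  have h3 : ∑ k : Fin s, ∑ j, companion M α β (⟨0, hM⟩, i) (Fin.castLE hsM k, j) *
        w (Fin.castLE hsM k, j) ≤ ∑ k, ∑ j, companion M α β (⟨0, hM⟩, i) (k, j) * w (k, j) := by
    refine (Finset.sum_map Finset.univ (Fin.castLEEmb hsM)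
      fun k => ∑ j, companion M α β (⟨0, hM⟩, i) (k, j) * w (k, j)).ge.trans ?_
    exact Finset.sum_le_sum_of_subset_of_nonneg (Finset.subset_univ _) fun k _ _ =>
      Finset.sum_nonneg fun j _ => mul_nonneg (hA _ _) (zero_le_one.trans (hw1 _))
  rw [Fintype.sum_prod_type] at h1
  rw [Finset.sum_comm]
  show _ ≤ w (⟨0, hM⟩, i)
  linarith

/-- The gauge is the sup norm weighted by 1/w. If W bounds all weights, then βw ≤ w − 1 ≤ (1 −
1/W)w, which is the contraction factor. -/
theorem CompanionContraction.isContraction {N s q : ℕ} {g : UpdateMap N s q}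
    (h : CompanionContraction g) : IsContraction g := by
  obtain ⟨α, β, hα, hβ, -, -, hg, hr⟩ := h
  have hw : ∃ w : Fin N → ℝ, (∀ i, 1 ≤ w i) ∧
      ∀ i, (∑ j, ∑ k : Fin s, w j * β i j k) + 1 ≤ w i := by
    -- For s = 0 the companion matrix may be empty, but then no lagged probability enters and unit
    -- weights do.
    rcases Nat.eq_zero_or_pos s with rfl | hs
    · exact ⟨fun _ => 1, by simp, by simp⟩
    · exact exists_weights_of_companion (le_max_left s q) (lt_max_of_lt_left hs) hα hβ hr
  obtain ⟨w, hw1, hw⟩ := hw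
  have hw0 : ∀ i, 0 < w i := fun i => zero_lt_one.trans_le (hw1 i)
  set W : ℝ := 1 + ∑ i, w i with hW
  have hWw : ∀ i, w i ≤ W := fun i => by
    have := Finset.single_le_sum (f := w) (fun i _ => (hw0 i).le) (Finset.mem_univ i)
    linarith
  have hW1 : 1 ≤ W := by
    have := Finset.sum_nonneg (s := Finset.univ) (f := w) fun i _ => (hw0 i).le
    linarith
  have hWinv : 0 < W⁻¹ := by positivity
  have hWinv1 : W⁻¹ ≤ 1 := inv_le_one_of_one_le₀ hW1
  have hdi : ∀ (x y : Fin N → unitInterval) i, |(x i : ℝ) - (y i : ℝ)| ≤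
      w i * ‖fun i => ((x i : ℝ) - (y i : ℝ)) / w i‖ := by
    intro x y i
    have h1 := norm_le_pi_norm (fun i => ((x i : ℝ) - (y i : ℝ)) / w i) i
    rw [Real.norm_eq_abs, abs_div, abs_of_pos (hw0 i), div_le_iff₀ (hw0 i)] at h1
    linarith
  refine ⟨fun x y => ‖fun i => ((x i : ℝ) - (y i : ℝ)) / w i‖, W, 1 - W⁻¹, by positivity,
    by linarith, by linarith, ?_, ?_, ?_, ?_⟩
  · intro x y z
    refine le_trans (le_of_eq ?_) (norm_add_le _ _)
    refine congrArg norm (funext fun i => ?_)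
    simp only [Pi.add_apply]
    ring
  · intro x y
    refine (pi_norm_le_iff_of_nonneg (by positivity)).2 fun i => ?_
    rw [Real.norm_eq_abs, abs_div, abs_of_pos (hw0 i), div_le_iff₀ (hw0 i)]
    have h1 := coord_abs_sub_le_dist x y i
    have h2 : 1 * dist x y * 1 ≤ W * dist x y * w i := by gcongr; exact hw1 i
    linarith
  · intro x y
    refine dist_le_of_coord (by positivity) fun i => (hdi x y i).trans ?_
    gcongr
    exact hWw i
  · intro P P' Y R hR hP
    refine (pi_norm_le_iff_of_nonneg (by have := sub_nonneg.2 hWinv1; positivity)).2 fun i => ?_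
    rw [Real.norm_eq_abs, abs_div, abs_of_pos (hw0 i), div_le_iff₀ (hw0 i)]
    have h1 := hg P P' Y Y i
    simp only [sub_self, abs_zero, zero_mul, Finset.sum_const_zero, add_zero] at h1
    have h2 : ∑ j, ∑ k : Fin s, |(P k j : ℝ) - (P' k j : ℝ)| * β i j k ≤
        R * ∑ j, ∑ k : Fin s, w j * β i j k := by
      simp_rw [Finset.mul_sum]
      refine Finset.sum_le_sum fun j _ => Finset.sum_le_sum fun k _ => ?_
      rw [← mul_assoc]
      refine mul_le_mul_of_nonneg_right ?_ (hβ _ _ _)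
      refine (hdi _ _ j).trans ?_
      rw [mul_comm]
      exact mul_le_mul_of_nonneg_right (hP k) (hw0 j).le
    have h3 : R * (∑ j, ∑ k : Fin s, w j * β i j k) ≤ R * (w i - 1) := by
      gcongr
      linarith [hw i]
    have h4 : W⁻¹ * w i ≤ 1 := by
      rw [inv_mul_le_iff₀ (by positivity), mul_one]
      exact hWw i
    have h5 : R * (W⁻¹ * w i) ≤ R * 1 := by gcongr
    nlinarith

/-! ### Forgetting of initial values and stability under perturbations -/

theorem IsContraction.exists_lipschitz {N s q : ℕ} {g : UpdateMap N s q} (h : IsContraction g) :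
    ∃ L : ℝ, 0 < L ∧ ∀ P P' Y r, 0 ≤ r → (∀ k, dist (P k) (P' k) ≤ r) →
      dist (g P Y) (g P' Y) ≤ L * r := by
  obtain ⟨d, C, κ, hC, hκ, hκ1, -, hd1, hd2, hg⟩ := h
  refine ⟨C * C, by positivity, fun P P' Y r hr hP => (hd2 _ _).trans ?_⟩
  have h1 := hg P P' Y (C * r) (by positivity) fun k => (hd1 _ _).trans (by gcongr; exact hP k)
  have h2 : κ * (C * r) ≤ 1 * (C * r) := by gcongr
  rw [mul_assoc]
  gcongr
  linarith

/-- An exact and an approximate solution of the recursion driven by the same inputs are close after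
a sufficiently long time, whatever their initial values. -/
theorem IsContraction.forgetting {N s q : ℕ} {g : UpdateMap N s q} (h : IsContraction g)
    {δ : ℝ} (hδ : 0 < δ) :
    ∃ η > 0, ∃ n : ℕ, ∀ (x x' : ℤ → Fin N → unitInterval) (Y : ℤ → Fin q → Fin N → Bool) (t : ℤ),
      (∀ τ, t - n < τ → τ ≤ t → x τ = g (fun k => x (τ - 1 - (k : ℤ))) (Y τ) ∧
        dist (x' τ) (g (fun k => x' (τ - 1 - (k : ℤ))) (Y τ)) ≤ η) →
      dist (x t) (x' t) ≤ δ := by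
  obtain ⟨d, C, κ, hC, hκ, hκ1, htri, hd1, hd2, hg⟩ := h
  have hκ' : 0 < 1 - κ := by linarith
  -- Half of δ is reserved for the initial discrepancy, half for the accumulated defects.
  set η : ℝ := δ * (1 - κ) / (2 * C * C) with hη
  have hη0 : 0 < η := by positivity
  -- One update looks back at most s steps, so each factor κ costs at most s + 1 time units. The
  -- term Cη/(1 − κ) is the fixed point of E ↦ κE + Cη.
  have key : ∀ (m : ℕ) (x x' : ℤ → Fin N → unitInterval) (Y : ℤ → Fin q → Fin N → Bool) (t : ℤ),
      (∀ τ, t - (m * (s + 1) : ℕ) < τ → τ ≤ t → x τ = g (fun k => x (τ - 1 - (k : ℤ))) (Y τ) ∧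
        dist (x' τ) (g (fun k => x' (τ - 1 - (k : ℤ))) (Y τ)) ≤ η) →
      d (x t) (x' t) ≤ κ ^ m * C + C * η / (1 - κ) := by
    intro m
    induction m with
    | zero =>
      intro x x' Y t _
      have h1 : C * dist (x t) (x' t) ≤ C * 1 := by gcongr; exact dist_le_one _ _
      have h2 : 0 ≤ C * η / (1 - κ) := by positivity
      linarith [hd1 (x t) (x' t)]
    | succ m ih =>
      intro x x' Y t ht
      obtain ⟨h1, h2⟩ := ht t (by push_cast; nlinarith) le_rfl
      have h3 := hg (fun k => x (t - 1 - (k : ℤ))) (fun k => x' (t - 1 - (k : ℤ))) (Y t)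
        (κ ^ m * C + C * η / (1 - κ)) (by positivity) fun k => by
          refine ih x x' Y _ fun τ hτ1 hτ2 => ht τ ?_ (by omega)
          have := k.2
          push_cast at hτ1 ⊢
          nlinarith
      have h4 := htri (x t) (g (fun k => x' (t - 1 - (k : ℤ))) (Y t)) (x' t)
      have h5 : d (g (fun k => x' (t - 1 - (k : ℤ))) (Y t)) (x' t) ≤ C * η := by
        refine (hd1 _ _).trans ?_
        rw [dist_comm]
        gcongr
      rw [← h1] at h3
      have h6 : C * η / (1 - κ) = κ * (C * η / (1 - κ)) + C * η := by
        field_simp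
        ring
      rw [pow_succ']
      nlinarith
  obtain ⟨m, hm⟩ := exists_pow_lt_of_lt_one (show 0 < δ / (2 * C * C) by positivity) hκ1
  refine ⟨η, hη0, m * (s + 1), fun x x' Y t ht => (hd2 _ _).trans ?_⟩
  have h1 := key m x x' Y t ht
  have h2 : κ ^ m * C ≤ δ / (2 * C * C) * C := by gcongr
  have h3 : C * (δ / (2 * C * C) * C + C * η / (1 - κ)) = δ := by
    rw [hη]
    field_simp
    ring
  rw [← h3]
  gcongr
  linarith

/-! ### Fitted probabilities as a path indexed by all times -/

/-- The fitted probabilities at all times `t ∈ ℤ`, extended by zero before the initial values. -/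
noncomputable def path {N s q : ℕ} (g : UpdateMap N s q) (y : ℤ → Fin N → Bool)
    (init : Fin s → Fin N → unitInterval) (t : ℤ) : Fin N → unitInterval :=
  if 0 < t then fittedNext g y init (t - 1).toNat
  else if h : (-t).toNat < s then init ⟨(-t).toNat, h⟩ else 0

theorem path_natCast_add_one {N s q : ℕ} (g : UpdateMap N s q) (y : ℤ → Fin N → Bool)
    (init : Fin s → Fin N → unitInterval) (t : ℕ) :
    path g y init ((t : ℤ) + 1) = fittedNext g y init t := by
  have h : (0 : ℤ) < (t : ℤ) + 1 := by omega
  simp [path, h]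

theorem fitted_eq_path {N s q : ℕ} (g : UpdateMap N s q) (y : ℤ → Fin N → Bool)
    (init : Fin s → Fin N → unitInterval) (t : ℕ) (k : Fin s) :
    fitted g y init t k = path g y init ((t : ℤ) - (k : ℤ)) := by
  induction t generalizing k with
  | zero =>
    have h : ¬ (0 : ℤ) < ((0 : ℕ) : ℤ) - (k : ℤ) := by omega
    simp [path, fitted]
  | succ t ih =>
    simp only [fitted]
    split_ifs with hk
    · rw [hk]
      push_cast
      rw [sub_zero, path_natCast_add_one, fittedNext]
    · rw [ih]
      congr 1
      have : ((k : ℕ) - 1 : ℕ) = (k : ℤ) - 1 := by omega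
      push_cast
      simp only [this]
      ring

theorem path_eq {N s q : ℕ} (g : UpdateMap N s q) (y : ℤ → Fin N → Bool)
    (init : Fin s → Fin N → unitInterval) {t : ℤ} (ht : 0 < t) :
    path g y init t = g (fun k => path g y init (t - 1 - (k : ℤ)))
      (fun j => y (t - 1 - (j : ℤ))) := by
  obtain ⟨n, rfl⟩ : ∃ n : ℕ, t = (n : ℤ) + 1 := ⟨(t - 1).toNat, by omega⟩
  rw [path_natCast_add_one, fittedNext]
  congr 1
  · ext1 k
    rw [fitted_eq_path, add_sub_cancel_right]
  · simp only [add_sub_cancel_right]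

theorem fitted_of_solution {N s q : ℕ} {g : UpdateMap N s q} {y : ℤ → Fin N → Bool}
    {x : ℤ → Fin N → unitInterval}
    (hx : ∀ t, x t = g (fun k => x (t - 1 - (k : ℤ))) (fun k => y (t - 1 - (k : ℤ)))) (t : ℕ) :
    fitted g y (fun k => x (-(k : ℤ))) t = fun k : Fin s => x ((t : ℤ) - (k : ℤ)) := by
  induction t with
  | zero => simp [fitted]
  | succ t ih =>
    ext1 k
    simp only [fitted]
    split_ifs with hk
    · rw [hk, ih, hx]
      push_cast
      simp
    · rw [ih]
      have : ((k : ℕ) - 1 : ℕ) = (k : ℤ) - 1 := by omega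
      push_cast
      simp only [this]
      congr 1
      ring

/-- This identifies the likelihood initialised at the true past with the score of the true
probabilities. -/
theorem fittedNext_of_solution {N s q : ℕ} {g : UpdateMap N s q} {y : ℤ → Fin N → Bool}
    {x : ℤ → Fin N → unitInterval}
    (hx : ∀ t, x t = g (fun k => x (t - 1 - (k : ℤ))) (fun k => y (t - 1 - (k : ℤ)))) (t : ℕ) :
    fittedNext g y (fun k => x (-(k : ℤ))) t = x ((t : ℤ) + 1) := by
  rw [fittedNext, fitted_of_solution hx, hx ((t : ℤ) + 1)]
  simp only [add_sub_cancel_right]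

section Continuity

variable {N s q m : ℕ} {g : EuclideanSpace ℝ (Fin m) → UpdateMap N s q}
  {Θ : Set (EuclideanSpace ℝ (Fin m))}

/-- Compactness of the space of arguments makes continuity in θ uniform over them. -/
theorem exists_nhds_update_dist_le
    (hcont : ContinuousOn
      (fun z : ((Fin s → Fin N → unitInterval) × (Fin q → Fin N → Bool)) ×
        EuclideanSpace ℝ (Fin m) => g z.2 z.1.1 z.1.2) (Set.univ ×ˢ Θ))
    {θ₁ : EuclideanSpace ℝ (Fin m)} (hθ₁ : θ₁ ∈ Θ) {η : ℝ} (hη : 0 < η) :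
    ∃ U ∈ 𝓝 θ₁, ∀ θ ∈ U ∩ Θ, ∀ P Y, dist (g θ P Y) (g θ₁ P Y) ≤ η := by
  have h1 : ContinuousOn (Function.uncurry fun (θ : EuclideanSpace ℝ (Fin m))
      (z : (Fin s → Fin N → unitInterval) × (Fin q → Fin N → Bool)) => g θ z.1 z.2)
      (Θ ×ˢ Set.univ) :=
    hcont.comp continuous_swap.continuousOn fun z hz => ⟨hz.2, hz.1⟩
  obtain ⟨V, hV, hV'⟩ := isCompact_univ.mem_uniformity_of_prod h1 hθ₁ (Metric.dist_mem_uniformity hη)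
  obtain ⟨U, hU, hUV⟩ := mem_nhdsWithin_iff_exists_mem_nhds_inter.1 hV
  exact ⟨U, hU, fun θ hθ P Y => (hV' θ (hUV hθ) (P, Y) (Set.mem_univ _)).le⟩

/-- The θ-path solves the θ₁-recursion up to η, so forgetting at θ₁ suffices and no contraction
constant uniform in θ is required. -/
theorem exists_nhds_fittedNext_dist_le
    (hcont : ContinuousOn
      (fun z : ((Fin s → Fin N → unitInterval) × (Fin q → Fin N → Bool)) ×
        EuclideanSpace ℝ (Fin m) => g z.2 z.1.1 z.1.2) (Set.univ ×ˢ Θ))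
    {θ₁ : EuclideanSpace ℝ (Fin m)} (hθ₁ : θ₁ ∈ Θ) (hc : IsContraction (g θ₁))
    {δ : ℝ} (hδ : 0 < δ) :
    ∃ U ∈ 𝓝 θ₁, ∃ n : ℕ, ∀ θ ∈ U ∩ Θ, ∀ y init init' (t : ℕ), n ≤ t →
      dist (fittedNext (g θ) y init t) (fittedNext (g θ₁) y init' t) ≤ δ := by
  obtain ⟨η, hη, n, hn⟩ := hc.forgetting hδ
  obtain ⟨U, hU, hUη⟩ := exists_nhds_update_dist_le hcont hθ₁ hη
  refine ⟨U, hU, n, fun θ hθ y init init' t ht => ?_⟩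
  rw [dist_comm, ← path_natCast_add_one, ← path_natCast_add_one]
  refine hn _ _ (fun τ j => y (τ - 1 - (j : ℤ))) _ fun τ hτ _ => ⟨path_eq _ _ _ (by omega), ?_⟩
  rw [path_eq (g θ) y init (show 0 < τ by omega)]
  exact hUη θ hθ _ _

end Continuity

/-! ### The log-likelihood -/

/-- The log-likelihood of a single outcome `v` under the success probabilities `a`. -/
noncomputable def logScore {N : ℕ} (v : Fin N → Bool) (a : Fin N → unitInterval) : ℝ :=
  ∑ i, (val (v i) * Real.log (a i : ℝ) + (1 - val (v i)) * Real.log (1 - (a i : ℝ)))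

theorem logLikelihood_eq {N s q : ℕ} (g : UpdateMap N s q) (y : ℤ → Fin N → Bool)
    (init : Fin s → Fin N → unitInterval) (T : ℕ) :
    logLikelihood g y init T =
      ∑ t ∈ Finset.range T, logScore (y ((t : ℤ) + 1)) (fittedNext g y init t) := rfl

theorem abs_log_sub_log_le {ε a b : ℝ} (hε : 0 < ε) (ha : ε ≤ a) (hb : ε ≤ b) :
    |Real.log a - Real.log b| ≤ |a - b| / ε := by
  have key : ∀ {a b : ℝ}, ε ≤ a → ε ≤ b → Real.log a - Real.log b ≤ |a - b| / ε := by
    intro a b ha hb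
    have ha0 := hε.trans_le ha
    have hb0 := hε.trans_le hb
    rw [← Real.log_div ha0.ne' hb0.ne']
    refine (Real.log_le_sub_one_of_pos (by positivity)).trans ?_
    have h1 : a / b - 1 = (a - b) / b := by field_simp
    rw [h1]
    calc (a - b) / b ≤ |a - b| / b := by gcongr; exact le_abs_self _
      _ ≤ |a - b| / ε := by gcongr
  refine abs_le.2 ⟨?_, key ha hb⟩
  have := key hb ha
  rw [abs_sub_comm] at this
  linarith

theorem abs_logScore_sub_le {N : ℕ} {ε : ℝ} (hε : 0 < ε) (v : Fin N → Bool)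
    {a b : Fin N → unitInterval} (ha : ∀ i, (a i : ℝ) ∈ Set.Icc ε (1 - ε))
    (hb : ∀ i, (b i : ℝ) ∈ Set.Icc ε (1 - ε)) :
    |logScore v a - logScore v b| ≤ N / ε * dist a b := by
  rw [logScore, logScore, ← Finset.sum_sub_distrib]
  refine (Finset.abs_sum_le_sum_abs _ _).trans ?_
  have h : ∀ i ∈ Finset.univ, |val (v i) * Real.log (a i : ℝ) +
      (1 - val (v i)) * Real.log (1 - (a i : ℝ)) - (val (v i) * Real.log (b i : ℝ) +
      (1 - val (v i)) * Real.log (1 - (b i : ℝ)))| ≤ dist a b / ε := by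
    intro i _
    have h1 : |(a i : ℝ) - b i| / ε ≤ dist a b / ε := by
      gcongr
      exact coord_abs_sub_le_dist a b i
    refine le_trans ?_ h1
    cases v i
    · simp only [val, Bool.false_eq_true, if_false, zero_mul, sub_zero, one_mul, zero_add]
      have := abs_log_sub_log_le hε (by linarith [(ha i).2] : ε ≤ 1 - (a i : ℝ))
        (by linarith [(hb i).2] : ε ≤ 1 - (b i : ℝ))
      rwa [sub_sub_sub_cancel_left, abs_sub_comm (b i : ℝ)] at this
    · simp only [val, if_true, sub_self, zero_mul, add_zero, one_mul]
      exact abs_log_sub_log_le hε (ha i).1 (hb i).1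
  refine (Finset.sum_le_sum h).trans (le_of_eq ?_)
  simp
  ring

/-- The first n summands cost at most N/ε each, the later ones at most δ each. The case θ = θ₁
serves to exchange initial values. -/
theorem exists_nhds_logLikelihood_sub_le {N s q m : ℕ}
    {g : EuclideanSpace ℝ (Fin m) → UpdateMap N s q} {Θ : Set (EuclideanSpace ℝ (Fin m))}
    (hcont : ContinuousOn
      (fun z : ((Fin s → Fin N → unitInterval) × (Fin q → Fin N → Bool)) ×
        EuclideanSpace ℝ (Fin m) => g z.2 z.1.1 z.1.2) (Set.univ ×ˢ Θ))
    {ε : ℝ} (hε : 0 < ε) (hbdd : ∀ θ ∈ Θ, ∀ P Y i, (g θ P Y i : ℝ) ∈ Set.Icc ε (1 - ε))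
    {θ₁ : EuclideanSpace ℝ (Fin m)} (hθ₁ : θ₁ ∈ Θ) (hc : IsContraction (g θ₁))
    {δ : ℝ} (hδ : 0 < δ) :
    ∃ U ∈ 𝓝 θ₁, ∃ C : ℝ, ∀ θ ∈ U ∩ Θ, ∀ y init init' (T : ℕ),
      |logLikelihood (g θ) y init T - logLikelihood (g θ₁) y init' T| ≤ δ * T + C := by
  obtain ⟨U, hU, n, hn⟩ := exists_nhds_fittedNext_dist_le hcont hθ₁ hc
    (show 0 < δ * ε / (N + 1) by positivity)
  refine ⟨U, hU, N / ε * n, fun θ hθ y init init' T => ?_⟩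
  rw [logLikelihood_eq, logLikelihood_eq, ← Finset.sum_sub_distrib]
  refine (Finset.abs_sum_le_sum_abs _ _).trans ?_
  have h : ∀ t ∈ Finset.range T, |logScore (y ((t : ℤ) + 1)) (fittedNext (g θ) y init t) -
      logScore (y ((t : ℤ) + 1)) (fittedNext (g θ₁) y init' t)| ≤
      δ + (if t < n then N / ε else 0) := by
    intro t _
    refine (abs_logScore_sub_le (a := fittedNext (g θ) y init t)
      (b := fittedNext (g θ₁) y init' t) hε _ (fun i => hbdd θ hθ.2 _ _ i)
      (fun i => hbdd θ₁ hθ₁ _ _ i)).trans ?_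
    split_ifs with ht
    · have : (N : ℝ) / ε * dist (fittedNext (g θ) y init t) (fittedNext (g θ₁) y init' t) ≤
        N / ε * 1 := by gcongr; exact dist_le_one _ _
      linarith
    · rw [add_zero]
      calc (N : ℝ) / ε * dist (fittedNext (g θ) y init t) (fittedNext (g θ₁) y init' t)
          ≤ N / ε * (δ * ε / (N + 1)) := by gcongr; exact hn θ hθ y init init' t (not_lt.1 ht)
        _ = δ * (N / (N + 1)) := by field_simp
        _ ≤ δ * 1 := by
          gcongr
          rw [div_le_one (by positivity)]
          linarith
        _ = δ := mul_one δ
  refine (Finset.sum_le_sum h).trans ?_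
  rw [Finset.sum_add_distrib, ← Finset.sum_filter, Finset.sum_const, Finset.sum_const,
    Finset.card_range, nsmul_eq_mul, nsmul_eq_mul, mul_comm]
  refine add_le_add_right ?_ _
  rw [mul_comm _ ((N : ℝ) / ε)]
  refine mul_le_mul_of_nonneg_left (Nat.cast_le.2 ?_) (div_nonneg N.cast_nonneg hε.le)
  refine (Finset.card_le_card (t := Finset.range n) fun t ht => ?_).trans_eq (Finset.card_range n)
  simpa using (Finset.mem_filter.1 ht).2

/-- A quadratic lower bound for the relative entropy of two Bernoulli laws. -/
theorem sq_sub_div_four_le_kl {a b : ℝ} (ha : 0 < a) (ha1 : a < 1) (hb : 0 < b) (hb1 : b < 1) :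
    (a - b) ^ 2 / 4 ≤ a * (Real.log a - Real.log b) +
      (1 - a) * (Real.log (1 - a) - Real.log (1 - b)) := by
  -- The bound log x ≤ x − 1 at x = √(u/r) leads to the Hellinger bound: the relative entropy is at
  -- least (√a − √b)², and (√a + √b)² ≤ 4.
  have key : ∀ {r u : ℝ}, 0 < r → 0 < u →
      2 * r - 2 * √r * √u ≤ r * (Real.log r - Real.log u) := by
    intro r u hr hu
    have h1 : Real.log (√u / √r) ≤ √u / √r - 1 := Real.log_le_sub_one_of_pos (by positivity)
    rw [Real.log_div (by positivity) (by positivity), Real.log_sqrt hu.le, Real.log_sqrt hr.le] at h1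
    have h2 : r * (√u / √r) = √r * √u := by
      nth_rewrite 1 [← Real.mul_self_sqrt hr.le]
      field_simp
    have h3 := mul_le_mul_of_nonneg_left h1 hr.le
    rw [mul_sub r (√u / √r), h2] at h3
    linarith
  have h1 := key ha hb
  have h2 := key (sub_pos.2 ha1) (sub_pos.2 hb1)
  have h3 : 2 * √(1 - a) * √(1 - b) ≤ (1 - a) + (1 - b) := by
    nlinarith [sq_nonneg (√(1 - a) - √(1 - b)), Real.mul_self_sqrt (sub_pos.2 ha1).le,
      Real.mul_self_sqrt (sub_pos.2 hb1).le]
  have h4 : a - b = (√a - √b) * (√a + √b) := by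
    nlinarith [Real.mul_self_sqrt ha.le, Real.mul_self_sqrt hb.le]
  have h5 : √a + √b ≤ 2 := by
    linarith [Real.sqrt_le_one.2 ha1.le, Real.sqrt_le_one.2 hb1.le]
  have h6 : (√a + √b) ^ 2 ≤ 2 ^ 2 := by gcongr
  have h7 : (a - b) ^ 2 / 4 ≤ (√a - √b) ^ 2 := by
    rw [h4, mul_pow]
    have := mul_le_mul_of_nonneg_left h6 (sq_nonneg (√a - √b))
    linarith
  nlinarith [Real.mul_self_sqrt ha.le, Real.mul_self_sqrt hb.le]

/-! ### Detecting a wrong parameter -/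

/-- If the updates of `g₀` and `g₁` differ somewhere along one solution `(x⋆, u)` of the recursion of
`g₀`, then they differ by a fixed amount along every solution whenever the outcomes match `u` over a
sufficiently long window. -/
theorem exists_pattern_update_dist_ge {N s q : ℕ} {g₀ g₁ : UpdateMap N s q}
    (h₀ : IsContraction g₀) (h₁ : IsContraction g₁)
    {u : ℤ → Fin N → Bool} {xs : ℤ → Fin N → unitInterval}
    (hxs : ∀ t, xs t = g₀ (fun k => xs (t - 1 - (k : ℤ))) (fun k => u (t - 1 - (k : ℤ)))) {c : ℤ}
    (hne : g₁ (fun k => xs (c - (k : ℤ))) (fun k => u (c - (k : ℤ))) ≠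
      g₀ (fun k => xs (c - (k : ℤ))) (fun k => u (c - (k : ℤ)))) :
    ∃ n : ℕ, ∃ δ > 0, ∀ (y : ℤ → Fin N → Bool) (x : ℤ → Fin N → unitInterval),
      (∀ t, x t = g₀ (fun k => x (t - 1 - (k : ℤ))) (fun k => y (t - 1 - (k : ℤ)))) →
      ∀ t : ℤ, (∀ k < n, y (t - (k : ℤ)) = u (c - (k : ℤ))) →
        δ ≤ dist (g₁ (fun k => x (t - (k : ℤ))) (fun k => y (t - (k : ℤ)))) (x (t + 1)) := by
  obtain ⟨L₀, hL₀, hg₀⟩ := h₀.exists_lipschitz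
  obtain ⟨L₁, hL₁, hg₁⟩ := h₁.exists_lipschitz
  set D := dist (g₁ (fun k => xs (c - (k : ℤ))) (fun k => u (c - (k : ℤ))))
    (g₀ (fun k => xs (c - (k : ℤ))) (fun k => u (c - (k : ℤ)))) with hD
  have hD0 : 0 < D := dist_pos.2 hne
  -- With the two paths this close, the updates of `g₀` and `g₁` move by at most D/2 together, so
  -- half of the discrepancy D survives.
  obtain ⟨η, hη, n, hn⟩ := h₀.forgetting (show 0 < D / (2 * (L₀ + L₁)) by positivity)
  -- The window covers n steps of forgetting before each of the s lagged times, and the q outcome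
  -- lags of each such step.
  refine ⟨n + s + q + 1, D / 2, by positivity, fun y x hx t ht => ?_⟩
  have hy : (fun k : Fin q => y (t - (k : ℤ))) = fun k : Fin q => u (c - (k : ℤ)) := by
    ext1 k
    exact ht k (by omega)
  have hclose : ∀ k : Fin s, dist (x (t - (k : ℤ))) (xs (c - (k : ℤ))) ≤ D / (2 * (L₀ + L₁)) := by
    intro k
    -- On the window, `xs` shifted in time solves the recursion driven by `y` exactly, with defect
    -- zero.
    have := hn x (fun τ => xs (τ + (c - t))) (fun τ j => y (τ - 1 - (j : ℤ))) (t - (k : ℤ))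
      fun τ hτ1 hτ2 => ⟨hx τ, ?_⟩
    · convert this using 3
      ring
    · have h1 : xs (τ + (c - t)) = g₀ (fun k => xs (τ - 1 - (k : ℤ) + (c - t)))
          (fun j => y (τ - 1 - (j : ℤ))) := by
        rw [hxs]
        congr 1
        · ext1 k
          congr 1
          ring
        · ext1 j
          have h2 := ht (t - (τ - 1 - (j : ℤ))).toNat (by omega)
          have h3 : ((t - (τ - 1 - (j : ℤ))).toNat : ℤ) = t - (τ - 1 - (j : ℤ)) := by omega
          rw [h3] at h2
          convert h2.symm using 2 <;> ring
      rw [h1, dist_self]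
      exact hη.le
  have hr : 0 ≤ D / (2 * (L₀ + L₁)) := by positivity
  have h2 := hg₀ (fun k => x (t - (k : ℤ))) (fun k => xs (c - (k : ℤ)))
    (fun k => u (c - (k : ℤ))) _ hr hclose
  have h3 := hg₁ (fun k => x (t - (k : ℤ))) (fun k => xs (c - (k : ℤ)))
    (fun k => u (c - (k : ℤ))) _ hr hclose
  have h4 : x (t + 1) = g₀ (fun k => x (t - (k : ℤ))) (fun k => u (c - (k : ℤ))) := by
    rw [hx, ← hy]
    simp only [add_sub_cancel_right]
  rw [hy, h4]
  have h5 := dist_triangle4 (g₁ (fun k => xs (c - (k : ℤ))) (fun k => u (c - (k : ℤ))))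
    (g₁ (fun k => x (t - (k : ℤ))) (fun k => u (c - (k : ℤ))))
    (g₀ (fun k => x (t - (k : ℤ))) (fun k => u (c - (k : ℤ))))
    (g₀ (fun k => xs (c - (k : ℤ))) (fun k => u (c - (k : ℤ))))
  rw [dist_comm] at h3
  have h6 : L₀ * (D / (2 * (L₀ + L₁))) + L₁ * (D / (2 * (L₀ + L₁))) = D / 2 := by
    field_simp
  linarith

/-- If the update of `g₁` along a path `x` misses `x`, then the probabilities fitted with `g₁` miss `x`
somewhere in the preceding window. -/
theorem exists_sum_sq_dist_fittedNext_ge {N s q : ℕ} {g₁ : UpdateMap N s q}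
    (h₁ : IsContraction g₁) {δ : ℝ} (hδ : 0 < δ) :
    ∃ η > 0, ∀ (y : ℤ → Fin N → Bool) (x : ℤ → Fin N → unitInterval)
      (init : Fin s → Fin N → unitInterval) (t : ℕ), s ≤ t →
      δ ≤ dist (g₁ (fun k => x ((t : ℤ) - (k : ℤ))) (fun k => y ((t : ℤ) - (k : ℤ))))
        (x ((t : ℤ) + 1)) →
      η ≤ ∑ k ∈ Finset.range (s + 1),
        dist (x (((t - k : ℕ) : ℤ) + 1)) (fittedNext g₁ y init (t - k)) ^ 2 := by
  obtain ⟨L, hL, hg⟩ := h₁.exists_lipschitz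
  -- If the last s + 1 fitted values were all within r of `x`, the update along `x` would miss `x`
  -- by at most (L + 1)r = δ/2.
  set r := δ / (2 * (L + 1)) with hr
  have hr0 : 0 < r := by positivity
  refine ⟨r ^ 2, by positivity, fun y x init t hst hδt => ?_⟩
  by_contra! hlt
  have hsmall : ∀ k ≤ s, dist (x (((t - k : ℕ) : ℤ) + 1)) (fittedNext g₁ y init (t - k)) < r := by
    intro k hk
    refine lt_of_pow_lt_pow_left₀ 2 hr0.le (lt_of_le_of_lt ?_ hlt)
    exact Finset.single_le_sum (f := fun k =>
      dist (x (((t - k : ℕ) : ℤ) + 1)) (fittedNext g₁ y init (t - k)) ^ 2)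
      (fun _ _ => sq_nonneg _) (Finset.mem_range.2 (by omega))
  have h1 : ∀ k : Fin s, dist (x ((t : ℤ) - (k : ℤ))) (fitted g₁ y init t k) ≤ r := by
    intro k
    have h2 := hsmall (k + 1) (by omega)
    rw [← path_natCast_add_one] at h2
    have h3 : ((t - ((k : ℕ) + 1) : ℕ) : ℤ) + 1 = (t : ℤ) - (k : ℤ) := by omega
    rw [h3] at h2
    rw [fitted_eq_path]
    exact h2.le
  have h2 := hg (fun k => x ((t : ℤ) - (k : ℤ))) (fitted g₁ y init t)
    (fun k => y ((t : ℤ) - (k : ℤ))) r hr0.le h1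
  have h3 := hsmall 0 (by omega)
  rw [Nat.sub_zero, dist_comm] at h3
  have h4 := dist_triangle (g₁ (fun k => x ((t : ℤ) - (k : ℤ))) (fun k => y ((t : ℤ) - (k : ℤ))))
    (fittedNext g₁ y init t) (x ((t : ℤ) + 1))
  have h5 : (L + 1) * r = δ / 2 := by
    rw [hr]
    field_simp
  have h6 : fittedNext g₁ y init t =
    g₁ (fitted g₁ y init t) (fun k => y ((t : ℤ) - (k : ℤ))) := rfl
  rw [← h6] at h2
  linarith

/-- For each offset k the map t ↦ t − k is injective on t ≥ s ≥ k, where the subtraction does not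
truncate, so each index is counted at most s + 1 times. -/
theorem sum_range_window_le {f : ℕ → ℝ} (hf : ∀ t, 0 ≤ f t) (s T : ℕ) :
    ∑ t ∈ Finset.Ico s T, ∑ k ∈ Finset.range (s + 1), f (t - k) ≤
      (s + 1) * ∑ t ∈ Finset.range T, f t := by
  rw [Finset.sum_comm]
  have h : ∀ k ∈ Finset.range (s + 1),
      ∑ t ∈ Finset.Ico s T, f (t - k) ≤ ∑ t ∈ Finset.range T, f t := by
    intro k hk
    have hk' := Finset.mem_range.1 hk
    rw [← Finset.sum_image (f := f) (s := Finset.Ico s T) (g := fun t => t - k)]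
    · refine Finset.sum_le_sum_of_subset_of_nonneg (fun j hj => ?_) fun _ _ _ => hf _
      obtain ⟨t, ht, rfl⟩ := Finset.mem_image.1 hj
      rw [Finset.mem_Ico] at ht
      exact Finset.mem_range.2 (by omega)
    · intro a ha b hb hab
      rw [Finset.mem_coe, Finset.mem_Ico] at ha hb
      simp only at hab
      omega
  refine (Finset.sum_le_sum h).trans (le_of_eq ?_)
  simp

/-! ### Weak law of large numbers for bounded martingale differences -/

section WeakLaw

variable {Ω : Type*} {mΩ : MeasurableSpace Ω} {μ : Measure Ω}

/-- Only monotonicity and subadditivity of the outer measure enter, so events quantified over θ need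
no measurability. -/
theorem tendsto_measure_zero_of_ae_imp_or {A B E : ℕ → Set Ω}
    (hA : Tendsto (fun T => μ (A T)) atTop (𝓝 0)) (hB : Tendsto (fun T => μ (B T)) atTop (𝓝 0))
    (h : ∀ᶠ T in atTop, ∀ᵐ ω ∂μ, ω ∈ E T → ω ∈ A T ∨ ω ∈ B T) :
    Tendsto (fun T => μ (E T)) atTop (𝓝 0) := by
  have h1 := hA.add hB
  rw [add_zero] at h1
  refine tendsto_of_tendsto_of_tendsto_of_le_of_le' tendsto_const_nhds h1
    (Eventually.of_forall fun _ => zero_le) ?_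
  filter_upwards [h] with T hT
  exact (measure_mono_ae hT).trans (measure_union_le _ _)

theorem tendsto_measure_zero_of_ae_imp_exists {ι : Type*} (I : Finset ι) {A : ι → ℕ → Set Ω}
    {E : ℕ → Set Ω} (hA : ∀ i ∈ I, Tendsto (fun T => μ (A i T)) atTop (𝓝 0))
    (h : ∀ᶠ T in atTop, ∀ᵐ ω ∂μ, ω ∈ E T → ∃ i ∈ I, ω ∈ A i T) :
    Tendsto (fun T => μ (E T)) atTop (𝓝 0) := by
  have h1 := tendsto_finsetSum I hA
  rw [Finset.sum_const_zero] at h1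
  refine tendsto_of_tendsto_of_tendsto_of_le_of_le' tendsto_const_nhds h1
    (Eventually.of_forall fun _ => zero_le) ?_
  filter_upwards [h] with T hT
  have h2 : μ (E T) ≤ μ (⋃ i ∈ I, A i T) := by
    refine measure_mono_ae ?_
    filter_upwards [hT] with ω hω hE
    obtain ⟨i, hi, hi'⟩ := hω hE
    exact Set.mem_biUnion hi hi'
  exact h2.trans (measure_biUnion_finset_le _ _)

theorem aestronglyMeasurable_finsetSum {ι : Type*} {m : MeasurableSpace Ω} (I : Finset ι)
    {f : ι → Ω → ℝ} (hf : ∀ i ∈ I, AEStronglyMeasurable[m] (f i) μ) :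
    AEStronglyMeasurable[m] (fun ω => ∑ i ∈ I, f i ω) μ := by
  classical
  induction I using Finset.induction_on with
  | empty => simpa using aestronglyMeasurable_const
  | insert i I hi ih =>
    simp_rw [Finset.sum_insert hi]
    exact (hf i (Finset.mem_insert_self i I)).add
      (ih fun j hj => hf j (Finset.mem_insert_of_mem hj))

theorem aestronglyMeasurable_finsetProd {ι : Type*} {m : MeasurableSpace Ω} (I : Finset ι)
    {f : ι → Ω → ℝ} (hf : ∀ i ∈ I, AEStronglyMeasurable[m] (f i) μ) :
    AEStronglyMeasurable[m] (fun ω => ∏ i ∈ I, f i ω) μ := by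
  classical
  induction I using Finset.induction_on with
  | empty => simpa using aestronglyMeasurable_const
  | insert i I hi ih =>
    simp_rw [Finset.prod_insert hi]
    exact (hf i (Finset.mem_insert_self i I)).mul
      (ih fun j hj => hf j (Finset.mem_insert_of_mem hj))

/-- Martingale differences are orthogonal, so the second moment of the sum is at most TC², and
Chebyshev's inequality gives the rate C²/(a²T). -/
theorem tendsto_measure_abs_sum_ge [IsProbabilityMeasure μ] {ℱ : ℕ → MeasurableSpace Ω}
    (hmono : Monotone ℱ) (hle : ∀ t, ℱ t ≤ mΩ) {D : ℕ → Ω → ℝ} {C : ℝ}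
    (hD : ∀ t, AEStronglyMeasurable[ℱ (t + 1)] (D t) μ) (hC : ∀ t, ∀ᵐ ω ∂μ, |D t ω| ≤ C)
    (hcond : ∀ t, μ[D t | ℱ t] =ᵐ[μ] 0) {a : ℝ} (ha : 0 < a) :
    Tendsto (fun T : ℕ => μ {ω | a * T ≤ |∑ t ∈ Finset.range T, D t ω|}) atTop (𝓝 0) := by
  have hSm : ∀ T : ℕ, AEStronglyMeasurable[ℱ T] (fun ω => ∑ t ∈ Finset.range T, D t ω) μ := by
    intro T
    exact aestronglyMeasurable_finsetSum _
      fun t ht => (hD t).mono (hmono (Finset.mem_range.1 ht))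
  have hSb : ∀ T : ℕ, ∀ᵐ ω ∂μ, |∑ t ∈ Finset.range T, D t ω| ≤ T * C := by
    intro T
    filter_upwards [ae_all_iff.2 hC] with ω hω
    refine (Finset.abs_sum_le_sum_abs _ _).trans
      ((Finset.sum_le_sum fun t _ => hω t).trans (le_of_eq ?_))
    simp
  have hbdd : ∀ {f : Ω → ℝ} {K : ℝ}, AEStronglyMeasurable f μ → (∀ᵐ ω ∂μ, |f ω| ≤ K) →
      Integrable f μ := fun hf hK => Integrable.of_bound hf _ hK
  have hDm : ∀ t, AEStronglyMeasurable (D t) μ := fun t => (hD t).mono (hle _)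
  have hSm' : ∀ T : ℕ, AEStronglyMeasurable (fun ω => ∑ t ∈ Finset.range T, D t ω) μ :=
    fun T => (hSm T).mono (hle _)
  have hDi : ∀ t, Integrable (D t) μ := fun t => hbdd (hDm t) (hC t)
  have hSDi : ∀ T : ℕ, Integrable ((fun ω => ∑ t ∈ Finset.range T, D t ω) * D T) μ := by
    intro T
    refine hbdd (K := T * C * C) ((hSm' T).mul (hDm T)) ?_
    filter_upwards [hSb T, hC T] with ω h1 h2
    rw [Pi.mul_apply, abs_mul]
    exact mul_le_mul h1 h2 (abs_nonneg _) ((abs_nonneg _).trans h1)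
  have hS2i : ∀ T : ℕ, Integrable (fun ω => (∑ t ∈ Finset.range T, D t ω) ^ 2) μ := by
    intro T
    refine hbdd (K := (T * C) ^ 2) ((hSm' T).pow 2) ?_
    filter_upwards [hSb T] with ω h1
    rw [abs_pow]
    gcongr
  have hD2i : ∀ T : ℕ, Integrable (fun ω => D T ω ^ 2) μ := by
    intro T
    refine hbdd (K := C ^ 2) ((hDm T).pow 2) ?_
    filter_upwards [hC T] with ω h1
    rw [abs_pow]
    gcongr
  have horth : ∀ T : ℕ, ∫ ω, ((fun ω => ∑ t ∈ Finset.range T, D t ω) * D T) ω ∂μ = 0 := by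
    intro T
    rw [← integral_condExp (hle T)]
    have h1 := condExp_mul_of_aestronglyMeasurable_left (hSm T) (hSDi T) (hDi T)
    rw [integral_congr_ae h1]
    refine integral_eq_zero_of_ae ?_
    filter_upwards [hcond T] with ω hω
    simp [hω]
  have hvar : ∀ T : ℕ, ∫ ω, (∑ t ∈ Finset.range T, D t ω) ^ 2 ∂μ ≤ T * C ^ 2 := by
    intro T
    induction T with
    | zero => simp
    | succ T ih =>
      have h1 : ∀ ω, (∑ t ∈ Finset.range (T + 1), D t ω) ^ 2 =
          (∑ t ∈ Finset.range T, D t ω) ^ 2 +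
            2 * ((fun ω => ∑ t ∈ Finset.range T, D t ω) * D T) ω + D T ω ^ 2 := by
        intro ω
        rw [Finset.sum_range_succ, Pi.mul_apply]
        ring
      have h3 : ∫ ω, (∑ t ∈ Finset.range (T + 1), D t ω) ^ 2 ∂μ =
          ∫ ω, (∑ t ∈ Finset.range T, D t ω) ^ 2 ∂μ +
            2 * ∫ ω, ((fun ω => ∑ t ∈ Finset.range T, D t ω) * D T) ω ∂μ +
              ∫ ω, D T ω ^ 2 ∂μ := by
        rw [← integral_const_mul, ← integral_add (hS2i T) ((hSDi T).const_mul 2)]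
        exact (integral_congr_ae (ae_of_all _ h1)).trans
          (integral_add ((hS2i T).add ((hSDi T).const_mul 2)) (hD2i T))
      rw [h3, horth]
      have h2 : ∫ ω, D T ω ^ 2 ∂μ ≤ ∫ _ω, C ^ 2 ∂μ := by
        refine integral_mono_ae (hD2i T) (integrable_const _) ?_
        filter_upwards [hC T] with ω h1
        rw [← sq_abs]
        gcongr
      rw [integral_const] at h2
      simp only [probReal_univ, smul_eq_mul, one_mul] at h2
      push_cast
      linarith
  have hreal : ∀ T : ℕ, 0 < T →
      μ.real {ω | a * T ≤ |∑ t ∈ Finset.range T, D t ω|} ≤ C ^ 2 / a ^ 2 * (T : ℝ)⁻¹ := by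
    intro T hT
    have hT' : (0 : ℝ) < T := by exact_mod_cast hT
    have h1 := mul_meas_ge_le_integral_of_nonneg
      (ae_of_all μ fun ω => sq_nonneg (∑ t ∈ Finset.range T, D t ω)) (hS2i T) ((a * T) ^ 2)
    have h2 : {ω | a * T ≤ |∑ t ∈ Finset.range T, D t ω|} =
        {ω | (a * T) ^ 2 ≤ (∑ t ∈ Finset.range T, D t ω) ^ 2} := by
      ext ω
      simp only [Set.mem_ofPred_eq]
      rw [sq_le_sq, abs_of_pos (by positivity : 0 < a * T)]
    rw [h2]
    have h3 := h1.trans (hvar T)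
    rw [← le_div_iff₀' (by positivity)] at h3
    refine h3.trans (le_of_eq ?_)
    field_simp
  have hlim : Tendsto (fun T : ℕ => C ^ 2 / a ^ 2 * (T : ℝ)⁻¹) atTop (𝓝 0) := by
    have := (tendsto_inv_atTop_nhds_zero_nat (𝕜 := ℝ)).const_mul (C ^ 2 / a ^ 2)
    rwa [mul_zero] at this
  have h1 : Tendsto (fun T : ℕ => μ.real {ω | a * T ≤ |∑ t ∈ Finset.range T, D t ω|})
      atTop (𝓝 0) := by
    refine tendsto_of_tendsto_of_tendsto_of_le_of_le' tendsto_const_nhds hlim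
      (Eventually.of_forall fun _ => measureReal_nonneg) ?_
    filter_upwards [eventually_gt_atTop 0] with T hT using hreal T hT
  exact (ENNReal.tendsto_toReal_zero_iff fun T => measure_ne_top μ _).1 h1

end WeakLaw

/-! ### Conditional moments of the outcomes -/

/-- The probability of the outcome `v` under independent Bernoulli components. -/
noncomputable def outcomeProb {N : ℕ} (v : Fin N → Bool) (a : Fin N → unitInterval) : ℝ :=
  ∏ i, if v i then (a i : ℝ) else 1 - (a i : ℝ)

/-- The sum over outcomes factors over the coordinates, and every factor other than the i-th equals
one. -/
theorem sum_val_mul_outcomeProb {N : ℕ} (a : Fin N → unitInterval) (i : Fin N) :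
    ∑ v : Fin N → Bool, val (v i) * outcomeProb v a = a i := by
  have h1 : ∀ v : Fin N → Bool, val (v i) * outcomeProb v a =
      ∏ j, (if j = i then val (v j) else 1) * (if v j then (a j : ℝ) else 1 - (a j : ℝ)) := by
    intro v
    rw [Finset.prod_mul_distrib, outcomeProb]
    simp
  simp_rw [h1]
  have h2 := Finset.prod_univ_sum (fun _ : Fin N => (Finset.univ : Finset Bool))
    fun j b => (if j = i then val b else 1) * (if b then (a j : ℝ) else 1 - (a j : ℝ))
  rw [Fintype.piFinset_univ] at h2
  rw [← h2]
  have h3 : ∀ j, ∑ b : Bool, (if j = i then val b else 1) *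
      (if b then (a j : ℝ) else 1 - (a j : ℝ)) = if j = i then (a j : ℝ) else 1 := by
    intro j
    rw [Fintype.sum_bool]
    by_cases hj : j = i <;> simp [hj, val]
  simp_rw [h3]
  simp

theorem outcomeProb_le_one {N : ℕ} (v : Fin N → Bool) (a : Fin N → unitInterval) :
    outcomeProb v a ≤ 1 := by
  refine Finset.prod_le_one (fun i _ => ?_) fun i _ => ?_ <;> split_ifs <;>
    linarith [(a i).2.1, (a i).2.2]

theorem pow_le_outcomeProb {N : ℕ} {ε : ℝ} (hε : 0 < ε) (v : Fin N → Bool)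
    {a : Fin N → unitInterval} (ha : ∀ i, (a i : ℝ) ∈ Set.Icc ε (1 - ε)) :
    ε ^ N ≤ outcomeProb v a := by
  have h : ∏ _i : Fin N, ε ≤ outcomeProb v a := by
    refine Finset.prod_le_prod (fun _ _ => hε.le) fun i _ => ?_
    split_ifs <;> linarith [(ha i).1, (ha i).2]
  simpa using h

section Outcomes

variable {Ω : Type*} {N s q : ℕ}
  {g : UpdateMap N s q} {y : ℤ → Ω → Fin N → Bool} {p : ℤ → Ω → Fin N → unitInterval}

theorem past_mono (y : ℤ → Ω → Fin N → Bool) : Monotone (past y) := fun _ _ hst =>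
  iSup_mono fun _ => iSup_mono' fun h => ⟨h.trans hst, le_rfl⟩

theorem measurable_past (y : ℤ → Ω → Fin N → Bool) {τ t : ℤ} (h : τ ≤ t) :
    Measurable[past y t] (y τ) :=
  measurable_iff_comap_le.2 (le_iSup₂_of_le τ h le_rfl)

variable [mΩ : MeasurableSpace Ω] {μ : Measure Ω}

theorem IsProcess.past_le (h : IsProcess μ g y p) (t : ℤ) : past y t ≤ mΩ :=
  iSup₂_le fun τ _ => (h.measurable_y τ).comap_le

theorem IsProcess.condExp_comp [IsProbabilityMeasure μ] (h : IsProcess μ g y p)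
    (F : (Fin N → Bool) → ℝ) (t : ℤ) :
    μ[fun ω => F (y (t + 1) ω) | past y t] =ᵐ[μ]
      fun ω => ∑ v, F v * outcomeProb v (p (t + 1) ω) := by
  have h1 : (fun ω => F (y (t + 1) ω)) =
      ∑ v, F v • Set.indicator {ω | y (t + 1) ω = v} (fun _ => (1 : ℝ)) := by
    ext ω
    simp [Finset.sum_apply, Set.indicator_apply]
  have hint : ∀ v, Integrable (Set.indicator {ω | y (t + 1) ω = v} (fun _ => (1 : ℝ))) μ :=
    fun v => (integrable_const _).indicator (h.measurable_y _ (measurableSet_singleton v))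
  rw [h1]
  refine (condExp_finsetSum (fun v _ => (hint v).smul (F v)) _).trans ?_
  have h2 : ∀ v, μ[F v • Set.indicator {ω | y (t + 1) ω = v} (fun _ => (1 : ℝ)) | past y t]
      =ᵐ[μ] fun ω => F v * outcomeProb v (p (t + 1) ω) := by
    intro v
    have h3 := h.condLaw (t + 1) v
    rw [add_sub_cancel_right] at h3
    filter_upwards [condExp_smul (μ := μ) (F v)
      (Set.indicator {ω | y (t + 1) ω = v} (fun _ => (1 : ℝ))) (past y t), h3] with ω h4 h5
    rw [h4, Pi.smul_apply, h5, smul_eq_mul, outcomeProb]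
  filter_upwards [ae_all_iff.2 h2] with ω hω
  rw [Finset.sum_apply]
  exact Finset.sum_congr rfl fun v _ => hω v

/-- Predictability of p is a consequence of the conditional law: p is almost surely the conditional
mean of y. It holds only up to null sets, hence almost everywhere measurability throughout. -/
theorem IsProcess.aestronglyMeasurable_p [IsProbabilityMeasure μ] (h : IsProcess μ g y p) (t : ℤ)
    (i : Fin N) : AEStronglyMeasurable[past y t] (fun ω => (p (t + 1) ω i : ℝ)) μ := by
  refine ⟨μ[fun ω => val (y (t + 1) ω i) | past y t], stronglyMeasurable_condExp, ?_⟩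
  filter_upwards [h.condExp_comp (fun v => val (v i)) t] with ω hω
  rw [hω, sum_val_mul_outcomeProb]

theorem aestronglyMeasurable_of_forall_coord {m : MeasurableSpace Ω} {a : Ω → Fin N → unitInterval}
    (ha : ∀ i, AEStronglyMeasurable[m] (fun ω => (a ω i : ℝ)) μ) (v : Fin N → Bool) :
    AEStronglyMeasurable[m] (fun ω => outcomeProb v (a ω)) μ := by
  refine aestronglyMeasurable_finsetProd Finset.univ fun i _ => ?_
  split_ifs
  · exact ha i
  · exact aestronglyMeasurable_const.sub (ha i)

/-- A predictable weight times a conditionally centred function of the next outcome is a martingale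
difference. -/
theorem IsProcess.tendsto_measure_abs_sum_ge [IsProbabilityMeasure μ] (h : IsProcess μ g y p)
    (F : (Fin N → Bool) → ℝ) {φ : ℕ → Ω → ℝ} {C : ℝ}
    (hφ : ∀ t : ℕ, AEStronglyMeasurable[past y t] (φ t) μ) (hC : ∀ t, ∀ᵐ ω ∂μ, |φ t ω| ≤ C)
    {a : ℝ} (ha : 0 < a) :
    Tendsto (fun T : ℕ => μ {ω | a * T ≤ |∑ t ∈ Finset.range T, φ t ω *
      (F (y ((t : ℤ) + 1) ω) - ∑ v, F v * outcomeProb v (p ((t : ℤ) + 1) ω))|}) atTop (𝓝 0) := by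
  set K : ℝ := ∑ v, |F v| with hK
  have hFy : ∀ t : ℕ, AEStronglyMeasurable[past y ((t + 1 : ℕ) : ℤ)]
      (fun ω => F (y ((t : ℤ) + 1) ω)) μ := by
    intro t
    have h1 : Measurable[past y ((t + 1 : ℕ) : ℤ)] (fun ω => F (y ((t : ℤ) + 1) ω)) :=
      (measurable_of_finite F).comp (measurable_past y (by push_cast; exact le_rfl))
    exact h1.stronglyMeasurable.aestronglyMeasurable
  have hp : ∀ t : ℕ, AEStronglyMeasurable[past y t]
      (fun ω => ∑ v, F v * outcomeProb v (p ((t : ℤ) + 1) ω)) μ := by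
    intro t
    exact aestronglyMeasurable_finsetSum Finset.univ fun v _ =>
      (aestronglyMeasurable_of_forall_coord (h.aestronglyMeasurable_p t) v).const_mul (F v)
  have hle1 : ∀ t : ℕ, past y (t : ℤ) ≤ past y ((t + 1 : ℕ) : ℤ) := fun t =>
    past_mono y (by push_cast; omega)
  have hbF : ∀ v, |F v| ≤ K := fun v =>
    Finset.single_le_sum (f := fun v => |F v|) (fun _ _ => abs_nonneg _) (Finset.mem_univ v)
  have hbP : ∀ a : Fin N → unitInterval, |∑ v, F v * outcomeProb v a| ≤ K := by
    intro a
    refine (Finset.abs_sum_le_sum_abs _ _).trans (Finset.sum_le_sum fun v _ => ?_)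
    have h1 : 0 ≤ outcomeProb v a := by
      refine Finset.prod_nonneg fun i _ => ?_
      split_ifs <;> linarith [(a i).2.1, (a i).2.2]
    rw [abs_mul, abs_of_nonneg h1]
    exact mul_le_of_le_one_right (abs_nonneg _) (outcomeProb_le_one v a)
  have hb : ∀ t : ℕ, ∀ ω, |F (y ((t : ℤ) + 1) ω) -
      ∑ v, F v * outcomeProb v (p ((t : ℤ) + 1) ω)| ≤ K + K := fun t ω =>
    (abs_sub _ _).trans (add_le_add (hbF _) (hbP _))
  have hm : ∀ t : ℕ, AEStronglyMeasurable[past y ((t + 1 : ℕ) : ℤ)]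
      (fun ω => F (y ((t : ℤ) + 1) ω) - ∑ v, F v * outcomeProb v (p ((t : ℤ) + 1) ω)) μ :=
    fun t => (hFy t).sub ((hp t).mono (hle1 t))
  have hint : ∀ t : ℕ, Integrable
      (fun ω => F (y ((t : ℤ) + 1) ω) - ∑ v, F v * outcomeProb v (p ((t : ℤ) + 1) ω)) μ :=
    fun t => Integrable.of_bound ((hm t).mono (h.past_le _)) (K + K) (ae_of_all _ (hb t))
  have hbD : ∀ t : ℕ, ∀ᵐ ω ∂μ, |φ t ω * (F (y ((t : ℤ) + 1) ω) -
      ∑ v, F v * outcomeProb v (p ((t : ℤ) + 1) ω))| ≤ C * (K + K) := by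
    intro t
    filter_upwards [hC t] with ω hω
    rw [abs_mul]
    exact mul_le_mul hω (hb t ω) (abs_nonneg _) ((abs_nonneg _).trans hω)
  refine GAB.tendsto_measure_abs_sum_ge (ℱ := fun t : ℕ => past y (t : ℤ))
    (fun a b hab => past_mono y (by exact_mod_cast hab)) (fun t => h.past_le _)
    (fun t => ((hφ t).mono (hle1 t)).mul (hm t)) hbD (fun t => ?_) ha
  have h1 := condExp_mul_of_aestronglyMeasurable_left (hφ t)
    (Integrable.of_bound (((hφ t).mono (h.past_le _)).mul ((hm t).mono (h.past_le _)))
      (C * (K + K)) (hbD t)) (hint t)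
  refine h1.trans ?_
  have hi1 : Integrable (fun ω => F (y ((t : ℤ) + 1) ω)) μ :=
    Integrable.of_bound ((hFy t).mono (h.past_le _)) K (ae_of_all _ fun ω => hbF _)
  have hi2 : Integrable (fun ω => ∑ v, F v * outcomeProb v (p ((t : ℤ) + 1) ω)) μ :=
    Integrable.of_bound ((hp t).mono (h.past_le _)) K (ae_of_all _ fun ω => hbP _)
  filter_upwards [condExp_sub hi1 hi2 (past y t), h.condExp_comp F t,
    condExp_of_aestronglyMeasurable' (h.past_le _) (hp t) hi2] with ω h2 h3 h4
  rw [Pi.mul_apply]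
  have h5 : μ[fun ω => F (y ((t : ℤ) + 1) ω) -
      ∑ v, F v * outcomeProb v (p ((t : ℤ) + 1) ω) | past y t] ω = 0 := by
    refine h2.trans ?_
    rw [Pi.sub_apply, h3, h4, sub_self]
  rw [h5, mul_zero]
  rfl

open Classical in
/-- Every finite pattern of outcomes occurs with positive frequency. -/
theorem IsProcess.exists_pattern_frequency [IsProbabilityMeasure μ] (h : IsProcess μ g y p)
    {ε : ℝ} (hε : 0 < ε) (hp : ∀ t : ℤ, ∀ᵐ ω ∂μ, ∀ i, (p t ω i : ℝ) ∈ Set.Icc ε (1 - ε))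
    (u : ℤ → Fin N → Bool) (n : ℕ) (c : ℤ) :
    ∃ κ > 0, Tendsto (fun T : ℕ => μ {ω | ∑ t ∈ Finset.range T,
      (if ∀ k < n, y ((t : ℤ) - (k : ℤ)) ω = u (c - (k : ℤ)) then (1 : ℝ) else 0) < κ * T})
      atTop (𝓝 0) := by
  induction n generalizing c with
  | zero =>
    refine ⟨1, one_pos, ?_⟩
    simp
  | succ n ih =>
    obtain ⟨κ, hκ, hlim⟩ := ih (c - 1)
    set φ : ℕ → Ω → ℝ := fun t ω =>
      if ∀ k < n, y ((t : ℤ) - (k : ℤ)) ω = u (c - 1 - (k : ℤ)) then (1 : ℝ) else 0 with hφ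
    set ψ : ℕ → Ω → ℝ := fun t ω =>
      if ∀ k < n + 1, y ((t : ℤ) - (k : ℤ)) ω = u (c - (k : ℤ)) then (1 : ℝ) else 0 with hψ
    set F : (Fin N → Bool) → ℝ := fun v => if v = u c then 1 else 0 with hF
    have hφ01 : ∀ t ω, 0 ≤ φ t ω ∧ φ t ω ≤ 1 := by
      intro t ω
      simp only [hφ]
      split_ifs <;> norm_num
    have hψ01 : ∀ t ω, 0 ≤ ψ t ω ∧ ψ t ω ≤ 1 := by
      intro t ω
      simp only [hψ]
      split_ifs <;> norm_num
    have hφm : ∀ t : ℕ, AEStronglyMeasurable[past y t] (φ t) μ := by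
      intro t
      have h1 : MeasurableSet[past y t]
          {ω | ∀ k < n, y ((t : ℤ) - (k : ℤ)) ω = u (c - 1 - (k : ℤ))} := by
        simp only [Set.ofPred_forall]
        refine MeasurableSet.iInter fun k => MeasurableSet.iInter fun _ => ?_
        exact measurable_past y (by omega : (t : ℤ) - (k : ℤ) ≤ t) (measurableSet_singleton _)
      have h2 : Measurable[past y t] (φ t) := Measurable.ite h1 measurable_const measurable_const
      exact h2.stronglyMeasurable.aestronglyMeasurable
    -- A match of length n + 1 is a match of length n one step earlier followed by the right
    -- outcome, which has conditional probability at least ε^N.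
    have hstep : ∀ t ω, ψ (t + 1) ω = φ t ω * F (y ((t : ℤ) + 1) ω) := by
      intro t ω
      have h1 : (∀ k < n + 1, y (((t + 1 : ℕ) : ℤ) - (k : ℤ)) ω = u (c - (k : ℤ))) ↔
          (∀ k < n, y ((t : ℤ) - (k : ℤ)) ω = u (c - 1 - (k : ℤ))) ∧
            y ((t : ℤ) + 1) ω = u c := by
        constructor
        · intro H
          refine ⟨fun k hk => ?_, ?_⟩
          · convert H (k + 1) (by omega) using 2 <;> push_cast <;> ring
          · convert H 0 (by omega) using 2 <;> push_cast <;> ring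
        · rintro ⟨H1, H2⟩ k hk
          cases k with
          | zero => convert H2 using 2 <;> push_cast <;> ring
          | succ k => convert H1 k (by omega) using 2 <;> push_cast <;> ring
      simp only [hψ, hφ, hF, h1]
      split_ifs <;> simp_all
    have hlln := h.tendsto_measure_abs_sum_ge F hφm
      (fun t => ae_of_all μ fun ω => abs_le.2 ⟨by linarith [(hφ01 t ω).1], (hφ01 t ω).2⟩)
      (show 0 < ε ^ N * κ / 2 by positivity)
    -- Of the expected frequency ε^N κ, half is lost to the fluctuation and a quarter to the
    -- boundary term 1 from shifting the index.
    refine ⟨ε ^ N * κ / 4, by positivity, tendsto_measure_zero_of_ae_imp_or hlim hlln ?_⟩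
    have hlarge := tendsto_natCast_atTop_atTop (R := ℝ) |>.eventually_ge_atTop
      (1 / (ε ^ N * κ / 4))
    filter_upwards [hlarge] with T hT
    filter_upwards [ae_all_iff.2 hp] with ω hω hbad
    by_contra! hgood
    obtain ⟨h1, h2⟩ := hgood
    change ∑ t ∈ Finset.range T, ψ t ω < _ at hbad
    change _ ≤ ∑ t ∈ Finset.range T, φ t ω at h1
    have h3 : ∑ t ∈ Finset.range T, ψ (t + 1) ω ≤ ∑ t ∈ Finset.range T, ψ t ω + 1 := by
      have h4 := Finset.sum_range_succ (fun t => ψ t ω) T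
      have h5 := Finset.sum_range_succ' (fun t => ψ t ω) T
      have h6 := (hψ01 T ω).2
      have h7 := (hψ01 0 ω).1
      linarith
    have h4 : ε ^ N * ∑ t ∈ Finset.range T, φ t ω ≤ ∑ t ∈ Finset.range T, φ t ω *
        ∑ v, F v * outcomeProb v (p ((t : ℤ) + 1) ω) := by
      rw [Finset.mul_sum]
      refine Finset.sum_le_sum fun t _ => ?_
      rw [mul_comm]
      refine mul_le_mul_of_nonneg_left ?_ (hφ01 t ω).1
      simp only [hF, ite_mul, one_mul, zero_mul, Finset.sum_ite_eq', Finset.mem_univ, if_true]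
      exact pow_le_outcomeProb hε _ (hω _)
    have h5 := (abs_lt.1 h2).1
    simp only [mul_sub, Finset.sum_sub_distrib, ← hstep] at h5
    have h6 : ε ^ N * (κ * T) ≤ ε ^ N * ∑ t ∈ Finset.range T, φ t ω := by gcongr
    rw [div_le_iff₀ (by positivity)] at hT
    linarith

end Outcomes

/-! ### The log-likelihood separates a wrong parameter from the truth -/

theorem IsContraction.continuous {N s q : ℕ} {g : UpdateMap N s q} (h : IsContraction g)
    (Y : Fin q → Fin N → Bool) : Continuous fun P => g P Y := by
  obtain ⟨L, hL, hg⟩ := h.exists_lipschitz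
  exact (LipschitzWith.of_dist_le_mul (K := ⟨L, hL.le⟩) fun P P' =>
    hg P P' Y _ dist_nonneg fun k => dist_le_pi_dist P P' k).continuous

theorem measurable_update {Ω : Type*} [MeasurableSpace Ω] {N s q : ℕ} {g : UpdateMap N s q}
    (hg : ∀ Y, Continuous fun P => g P Y) {A : Ω → Fin s → Fin N → unitInterval}
    {B : Ω → Fin q → Fin N → Bool} (hA : Measurable A) (hB : Measurable B) :
    Measurable fun ω => g (A ω) (B ω) := by
  have h : Measurable fun z : (Fin s → Fin N → unitInterval) × (Fin q → Fin N → Bool) =>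
      g z.1 z.2 := measurable_from_prod_countable_left fun Y => (hg Y).measurable
  exact h.comp (hA.prodMk hB)

theorem measurable_fitted {Ω : Type*} [MeasurableSpace Ω] {N s q : ℕ} {g : UpdateMap N s q}
    (hg : ∀ Y, Continuous fun P => g P Y) {y : ℤ → Ω → Fin N → Bool}
    (init : Fin s → Fin N → unitInterval) (t : ℕ) (hy : ∀ τ : ℤ, τ < t → Measurable (y τ)) :
    Measurable fun ω => fitted g (fun τ => y τ ω) init t := by
  induction t with
  | zero => exact measurable_const
  | succ t ih =>
    have h1 := ih fun τ hτ => hy τ (by push_cast; omega)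
    refine measurable_pi_lambda _ fun k => ?_
    simp only [fitted]
    split_ifs with hk
    · exact measurable_update hg h1 (measurable_pi_lambda _ fun j => hy _ (by push_cast; omega))
    · exact (measurable_pi_apply _).comp h1

theorem measurable_fittedNext {Ω : Type*} [MeasurableSpace Ω] {N s q : ℕ} {g : UpdateMap N s q}
    (hg : ∀ Y, Continuous fun P => g P Y) {y : ℤ → Ω → Fin N → Bool}
    (init : Fin s → Fin N → unitInterval) (t : ℕ) (hy : ∀ τ : ℤ, τ ≤ t → Measurable (y τ)) :
    Measurable fun ω => fittedNext g (fun τ => y τ ω) init t :=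
  measurable_update hg (measurable_fitted hg init t fun τ hτ => hy τ hτ.le)
    (measurable_pi_lambda _ fun j => hy _ (by omega))

theorem aestronglyMeasurable_log {Ω : Type*} {m _ : MeasurableSpace Ω} {μ : Measure Ω} {f : Ω → ℝ}
    (hf : AEStronglyMeasurable[m] f μ) :
    AEStronglyMeasurable[m] (fun ω => Real.log (f ω)) μ := by
  obtain ⟨f', hf', he⟩ := hf
  refine ⟨fun ω => Real.log (f' ω), (Real.measurable_log.comp hf'.measurable).stronglyMeasurable, ?_⟩
  filter_upwards [he] with ω hω
  rw [hω]

theorem abs_log_le {ε x : ℝ} (hε : 0 < ε) (h : ε ≤ x) (h1 : x ≤ 1) :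
    |Real.log x| ≤ -Real.log ε := by
  rw [abs_of_nonpos (Real.log_nonpos (hε.le.trans h) h1)]
  exact neg_le_neg (Real.log_le_log hε h)

theorem sq_dist_le_sum {N : ℕ} (a b : Fin N → unitInterval) :
    dist a b ^ 2 ≤ ∑ i, ((a i : ℝ) - b i) ^ 2 := by
  have h0 : 0 ≤ ∑ i, ((a i : ℝ) - b i) ^ 2 := Finset.sum_nonneg fun _ _ => sq_nonneg _
  have h1 : dist a b ≤ √(∑ i, ((a i : ℝ) - b i) ^ 2) :=
    dist_le_of_coord (Real.sqrt_nonneg _) fun i => Real.abs_le_sqrt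
      (Finset.single_le_sum (f := fun i => ((a i : ℝ) - b i) ^ 2) (fun _ _ => sq_nonneg _)
        (Finset.mem_univ i))
  calc dist a b ^ 2 ≤ √(∑ i, ((a i : ℝ) - b i) ^ 2) ^ 2 := by gcongr
    _ = _ := Real.sq_sqrt h0

/-- The log-odds of `a` minus the log-odds of `b`. -/
noncomputable def logOddsDiff (a b : ℝ) : ℝ :=
  Real.log a - Real.log (1 - a) - (Real.log b - Real.log (1 - b))

theorem aestronglyMeasurable_logOddsDiff {Ω : Type*} {m _ : MeasurableSpace Ω} {μ : Measure Ω}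
    {f f' : Ω → ℝ} (hf : AEStronglyMeasurable[m] f μ) (hf' : AEStronglyMeasurable[m] f' μ) :
    AEStronglyMeasurable[m] (fun ω => logOddsDiff (f ω) (f' ω)) μ := by
  have h1 : AEStronglyMeasurable[m] (fun _ : Ω => (1 : ℝ)) μ := aestronglyMeasurable_const
  have h2 := aestronglyMeasurable_log (h1.sub hf)
  have h3 := aestronglyMeasurable_log (h1.sub hf')
  exact ((aestronglyMeasurable_log hf).sub h2).sub ((aestronglyMeasurable_log hf').sub h3)

theorem abs_logOddsDiff_le {ε a b : ℝ} (hε : 0 < ε) (ha : a ∈ Set.Icc ε (1 - ε))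
    (hb : b ∈ Set.Icc ε (1 - ε)) : |logOddsDiff a b| ≤ 4 * -Real.log ε := by
  have h1 := abs_le.1 (abs_log_le hε ha.1 (by linarith [ha.2]))
  have h2 := abs_le.1 (abs_log_le hε (by linarith [ha.2] : ε ≤ 1 - a) (by linarith [ha.1]))
  have h3 := abs_le.1 (abs_log_le hε hb.1 (by linarith [hb.2]))
  have h4 := abs_le.1 (abs_log_le hε (by linarith [hb.2] : ε ≤ 1 - b) (by linarith [hb.1]))
  rw [logOddsDiff]
  exact abs_le.2 ⟨by linarith, by linarith⟩

/-- The score difference is affine in each outcome with the log-odds difference as slope; centring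
the outcome at `a` leaves the relative entropy of `a` with respect to `b`. -/
theorem sum_add_sq_dist_le_logScore_sub {N : ℕ} {ε : ℝ} (hε : 0 < ε) (v : Fin N → Bool)
    {a b : Fin N → unitInterval} (ha : ∀ i, (a i : ℝ) ∈ Set.Icc ε (1 - ε))
    (hb : ∀ i, (b i : ℝ) ∈ Set.Icc ε (1 - ε)) :
    ∑ i, logOddsDiff (a i) (b i) * (val (v i) - a i) + dist a b ^ 2 / 4 ≤
      logScore v a - logScore v b := by
  have h1 : dist a b ^ 2 / 4 ≤ ∑ i, ((a i : ℝ) - b i) ^ 2 / 4 := by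
    rw [← Finset.sum_div]
    gcongr
    exact sq_dist_le_sum a b
  refine (add_le_add_right h1 _).trans ?_
  rw [logScore, logScore, ← Finset.sum_sub_distrib, ← Finset.sum_add_distrib]
  refine Finset.sum_le_sum fun i _ => ?_
  have h2 := sq_sub_div_four_le_kl (a := a i) (b := b i) (hε.trans_le (ha i).1)
    (by linarith [(ha i).2]) (hε.trans_le (hb i).1) (by linarith [(hb i).2])
  rw [logOddsDiff]
  linarith

section Gap

variable {Ω : Type*} [mΩ : MeasurableSpace Ω] {μ : Measure Ω} {N s q : ℕ}
  {g₀ g₁ : UpdateMap N s q} {y : ℤ → Ω → Fin N → Bool} {p : ℤ → Ω → Fin N → unitInterval} {ε : ℝ}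

theorem IsProcess.ae_mem_Icc (h : IsProcess μ g₀ y p)
    (hb₀ : ∀ P Y i, (g₀ P Y i : ℝ) ∈ Set.Icc ε (1 - ε)) (t : ℤ) :
    ∀ᵐ ω ∂μ, ∀ i, (p t ω i : ℝ) ∈ Set.Icc ε (1 - ε) := by
  filter_upwards [h.update t] with ω hω i
  rw [hω]
  exact hb₀ _ _ i

variable [IsProbabilityMeasure μ]

/-- The initial value is deterministic here: the fitted probabilities, hence the weights, are then
predictable. -/
theorem IsProcess.tendsto_measure_logOdds_sum (h : IsProcess μ g₀ y p) (h₁ : IsContraction g₁)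
    (hε : 0 < ε) (hb₀ : ∀ P Y i, (g₀ P Y i : ℝ) ∈ Set.Icc ε (1 - ε))
    (hb₁ : ∀ P Y i, (g₁ P Y i : ℝ) ∈ Set.Icc ε (1 - ε)) (init : Fin s → Fin N → unitInterval)
    {a : ℝ} (ha : 0 < a) :
    Tendsto (fun T : ℕ => μ {ω | ∃ i, a * T ≤ |∑ t ∈ Finset.range T,
      logOddsDiff (p ((t : ℤ) + 1) ω i) (fittedNext g₁ (fun τ => y τ ω) init t i) *
        (val (y ((t : ℤ) + 1) ω i) - p ((t : ℤ) + 1) ω i)|}) atTop (𝓝 0) := by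
  refine tendsto_measure_zero_of_ae_imp_exists Finset.univ
    (A := fun i T => {ω | a * T ≤ |∑ t ∈ Finset.range T,
      logOddsDiff (p ((t : ℤ) + 1) ω i) (fittedNext g₁ (fun τ => y τ ω) init t i) *
        (val (y ((t : ℤ) + 1) ω i) - p ((t : ℤ) + 1) ω i)|}) (fun i _ => ?_)
    (Eventually.of_forall fun T => ae_of_all _ fun ω ⟨i, hi⟩ => ⟨i, Finset.mem_univ i, hi⟩)
  have hm : ∀ t : ℕ, AEStronglyMeasurable[past y t] (fun ω =>
      logOddsDiff (p ((t : ℤ) + 1) ω i) (fittedNext g₁ (fun τ => y τ ω) init t i)) μ := by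
    intro t
    have hp := h.aestronglyMeasurable_p (t : ℤ) i
    have hf : Measurable[past y t] fun ω => fittedNext g₁ (fun τ => y τ ω) init t :=
      @measurable_fittedNext Ω (past y t) N s q g₁ h₁.continuous y init t
        fun τ hτ => measurable_past y hτ
    have hf' : AEStronglyMeasurable[past y t]
        (fun ω => (fittedNext g₁ (fun τ => y τ ω) init t i : ℝ)) μ :=
      (measurable_subtype_coe.comp
        ((measurable_pi_apply i).comp hf)).stronglyMeasurable.aestronglyMeasurable
    exact aestronglyMeasurable_logOddsDiff hp hf'
  have hlln := h.tendsto_measure_abs_sum_ge (fun v => val (v i)) hm (fun t => by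
    filter_upwards [h.ae_mem_Icc hb₀ ((t : ℤ) + 1)] with ω hω
    exact abs_logOddsDiff_le hε (hω i) (hb₁ _ _ i)) ha
  simp only [sum_val_mul_outcomeProb] at hlln
  exact hlln

/-- If `g₁` is distinguishable from the true update function, then the log-likelihood of the true
probabilities exceeds the one of the probabilities fitted with `g₁` by a multiple of the sample size,
with probability tending to one. -/
theorem IsProcess.exists_logScore_gap (h : IsProcess μ g₀ y p) (h₀ : IsContraction g₀)
    (h₁ : IsContraction g₁) (hε : 0 < ε) (hb₀ : ∀ P Y i, (g₀ P Y i : ℝ) ∈ Set.Icc ε (1 - ε))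
    (hb₁ : ∀ P Y i, (g₁ P Y i : ℝ) ∈ Set.Icc ε (1 - ε)) (init : Fin s → Fin N → unitInterval)
    {c : ℤ} (hne : ¬ ∀ᵐ ω ∂μ,
      g₁ (fun k => p (c - (k : ℤ)) ω) (fun k => y (c - (k : ℤ)) ω) =
        g₀ (fun k => p (c - (k : ℤ)) ω) (fun k => y (c - (k : ℤ)) ω)) :
    ∃ r > 0, Tendsto (fun T : ℕ => μ {ω |
      ∑ t ∈ Finset.range T, logScore (y ((t : ℤ) + 1) ω) (p ((t : ℤ) + 1) ω) -
        logLikelihood g₁ (fun τ => y τ ω) init T < r * T}) atTop (𝓝 0) := by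
  classical
  have hupd : ∀ᵐ ω ∂μ, ∀ t : ℤ,
      p t ω = g₀ (fun k => p (t - 1 - (k : ℤ)) ω) (fun k => y (t - 1 - (k : ℤ)) ω) :=
    ae_all_iff.2 h.update
  -- A single sample point where the updates differ at time c and the recursion holds at all times;
  -- its outcomes are the pattern to be repeated.
  obtain ⟨ωs, hωs, hωs'⟩ := ((not_eventually.1 hne).and_eventually hupd).exists
  obtain ⟨n, δ, hδ, hpat⟩ := exists_pattern_update_dist_ge h₀ h₁ (u := fun t => y t ωs)
    (xs := fun t => p t ωs) hωs' hωs
  obtain ⟨η, hη, hwin⟩ := exists_sum_sq_dist_fittedNext_ge h₁ hδ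
  obtain ⟨κ, hκ, hfreq⟩ :=
    h.exists_pattern_frequency hε (h.ae_mem_Icc hb₀) (fun t => y t ωs) n c
  -- The 4 comes from the entropy bound, s + 1 from the overlap of the windows.
  set ρ : ℝ := η / (4 * (s + 1)) with hρ
  have hρ0 : 0 < ρ := by positivity
  have hlln := h.tendsto_measure_logOdds_sum h₁ hε hb₀ hb₁ init
    (show 0 < ρ * κ / (4 * (N + 1)) by positivity)
  -- From ρκ, one quarter is lost to the first s times and one quarter to the martingale terms of
  -- the N coordinates.
  refine ⟨ρ * κ / 2, by positivity, tendsto_measure_zero_of_ae_imp_or hfreq hlln ?_⟩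
  filter_upwards [eventually_ge_atTop s,
    tendsto_natCast_atTop_atTop (R := ℝ) |>.eventually_ge_atTop (4 * s / κ)] with T hsT hT
  filter_upwards [hupd, ae_all_iff.2 (h.ae_mem_Icc hb₀)] with ω hω hωb hbad
  by_contra! hgood
  obtain ⟨hg1, hg2⟩ := hgood
  set M : ℕ → ℝ := fun t =>
    if ∀ k < n, y ((t : ℤ) - (k : ℤ)) ω = y (c - (k : ℤ)) ωs then (1 : ℝ) else 0 with hM
  set b : ℕ → Fin N → unitInterval := fun t => fittedNext g₁ (fun τ => y τ ω) init t with hb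
  change ∑ t ∈ Finset.range T, logScore (y ((t : ℤ) + 1) ω) (p ((t : ℤ) + 1) ω) -
    ∑ t ∈ Finset.range T, logScore (y ((t : ℤ) + 1) ω) (b t) < _ at hbad
  replace hg1 : κ * T ≤ ∑ t ∈ Finset.range T, M t := hg1
  replace hg2 : ∀ i, |∑ t ∈ Finset.range T, logOddsDiff (p ((t : ℤ) + 1) ω i) (b t i) *
      (val (y ((t : ℤ) + 1) ω i) - p ((t : ℤ) + 1) ω i)| < ρ * κ / (4 * (N + 1)) * T := hg2
  have hM1 : ∀ t, M t ≤ 1 := fun t => by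
    simp only [hM]
    split_ifs <;> norm_num
  have hkl : ∑ t ∈ Finset.range T, (∑ i, logOddsDiff (p ((t : ℤ) + 1) ω i) (b t i) *
      (val (y ((t : ℤ) + 1) ω i) - p ((t : ℤ) + 1) ω i) +
        dist (p ((t : ℤ) + 1) ω) (b t) ^ 2 / 4) ≤
      ∑ t ∈ Finset.range T, (logScore (y ((t : ℤ) + 1) ω) (p ((t : ℤ) + 1) ω) -
        logScore (y ((t : ℤ) + 1) ω) (b t)) :=
    Finset.sum_le_sum fun t _ => sum_add_sq_dist_le_logScore_sub hε _ (hωb _) fun i => hb₁ _ _ i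
  rw [Finset.sum_add_distrib, Finset.sum_sub_distrib, Finset.sum_comm, ← Finset.sum_div] at hkl
  have hmart : -(ρ * κ / 4 * T) ≤ ∑ i, ∑ t ∈ Finset.range T,
      logOddsDiff (p ((t : ℤ) + 1) ω i) (b t i) *
        (val (y ((t : ℤ) + 1) ω i) - p ((t : ℤ) + 1) ω i) := by
    have h2 : ∑ _i : Fin N, -(ρ * κ / (4 * (N + 1)) * T) ≤ ∑ i, ∑ t ∈ Finset.range T,
        logOddsDiff (p ((t : ℤ) + 1) ω i) (b t i) *
          (val (y ((t : ℤ) + 1) ω i) - p ((t : ℤ) + 1) ω i) :=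
      Finset.sum_le_sum fun i _ => (abs_lt.1 (hg2 i)).1.le
    refine le_trans ?_ h2
    rw [Finset.sum_const, Finset.card_univ, Fintype.card_fin, nsmul_eq_mul, mul_neg]
    refine neg_le_neg ?_
    have h3 : (N : ℝ) * (ρ * κ / (4 * (N + 1)) * T) = ρ * κ / 4 * T * (N / (N + 1)) := by
      field_simp
    rw [h3]
    refine mul_le_of_le_one_right (by positivity) ?_
    rw [div_le_one (by positivity)]
    linarith
  have hwindow : η * ∑ t ∈ Finset.Ico s T, M t ≤
      (s + 1) * ∑ t ∈ Finset.range T, dist (p ((t : ℤ) + 1) ω) (b t) ^ 2 := by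
    refine le_trans ?_ (sum_range_window_le
      (f := fun t : ℕ => dist (p ((t : ℤ) + 1) ω) (b t) ^ 2) (fun _ => sq_nonneg _) s T)
    rw [Finset.mul_sum]
    refine Finset.sum_le_sum fun t ht => ?_
    simp only [hM]
    split_ifs with hm
    · rw [mul_one]
      exact hwin (fun τ => y τ ω) (fun τ => p τ ω) init t (Finset.mem_Ico.1 ht).1
        (hpat (fun τ => y τ ω) (fun τ => p τ ω) hω t hm)
    · rw [mul_zero]
      exact Finset.sum_nonneg fun _ _ => sq_nonneg _
  have hsplit : ∑ t ∈ Finset.range T, M t ≤ s + ∑ t ∈ Finset.Ico s T, M t := by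
    rw [← Finset.sum_range_add_sum_Ico _ hsT]
    gcongr
    refine (Finset.sum_le_sum fun t _ => hM1 t).trans (le_of_eq ?_)
    simp
  have h5 : ρ * (κ * T - s) ≤ (∑ t ∈ Finset.range T, dist (p ((t : ℤ) + 1) ω) (b t) ^ 2) / 4 := by
    have h6 : η * (κ * T - s) ≤ η * ∑ t ∈ Finset.Ico s T, M t := by
      gcongr
      linarith
    have h7 := h6.trans hwindow
    rw [hρ, div_mul_eq_mul_div, div_le_div_iff₀ (by positivity) (by positivity)]
    linarith
  have h6 : ρ * s ≤ ρ * (κ * T / 4) := by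
    gcongr
    rw [div_le_iff₀ hκ] at hT
    linarith
  linarith

end Gap

/-! ### Consistency -/

/-- The random initial values are exchanged deterministically: for constants near θ₁, for the true
past at θ₀. Each exchange costs rT/4 plus a constant, against a gap of rT. -/
theorem exists_nhds_tendsto_measure_logLikelihood_le {Ω : Type*} [MeasurableSpace Ω]
    {μ : Measure Ω} [IsProbabilityMeasure μ] {N s q m : ℕ}
    {g : EuclideanSpace ℝ (Fin m) → UpdateMap N s q} {Θ : Set (EuclideanSpace ℝ (Fin m))}
    {θ₀ θ₁ : EuclideanSpace ℝ (Fin m)} {y : ℤ → Ω → Fin N → Bool}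
    {p : ℤ → Ω → Fin N → unitInterval} (hmodel : IsProcess μ (g θ₀) y p) (hθ₀ : θ₀ ∈ Θ)
    (hcont : ContinuousOn
      (fun z : ((Fin s → Fin N → unitInterval) × (Fin q → Fin N → Bool)) ×
        EuclideanSpace ℝ (Fin m) => g z.2 z.1.1 z.1.2) (Set.univ ×ˢ Θ))
    {ε : ℝ} (hε : 0 < ε) (hbdd : ∀ θ ∈ Θ, ∀ P Y i, (g θ P Y i : ℝ) ∈ Set.Icc ε (1 - ε))
    (hc : ∀ θ ∈ Θ, IsContraction (g θ)) (hθ₁ : θ₁ ∈ Θ) {c : ℤ}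
    (hne : ¬ ∀ᵐ ω ∂μ, g θ₁ (fun k => p (c - (k : ℤ)) ω) (fun k => y (c - (k : ℤ)) ω) =
      g θ₀ (fun k => p (c - (k : ℤ)) ω) (fun k => y (c - (k : ℤ)) ω))
    (init : ℕ → Ω → Fin s → Fin N → unitInterval) :
    ∃ U ∈ 𝓝 θ₁, Tendsto (fun T : ℕ => μ {ω | ∃ θ ∈ U ∩ Θ,
      logLikelihood (g θ₀) (fun t => y t ω) (init T ω) T ≤
        logLikelihood (g θ) (fun t => y t ω) (init T ω) T}) atTop (𝓝 0) := by
  obtain ⟨r, hr, hgap⟩ := hmodel.exists_logScore_gap (hc θ₀ hθ₀) (hc θ₁ hθ₁) hε (hbdd θ₀ hθ₀)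
    (hbdd θ₁ hθ₁) (fun _ _ => 0) hne
  obtain ⟨U₁, hU₁, C₁, hC₁⟩ := exists_nhds_logLikelihood_sub_le hcont hε hbdd hθ₁ (hc θ₁ hθ₁)
    (show 0 < r / 4 by positivity)
  obtain ⟨U₀, hU₀, C₀, hC₀⟩ := exists_nhds_logLikelihood_sub_le hcont hε hbdd hθ₀ (hc θ₀ hθ₀)
    (show 0 < r / 4 by positivity)
  refine ⟨U₁, hU₁, tendsto_measure_zero_of_ae_imp_or hgap hgap ?_⟩
  filter_upwards [tendsto_natCast_atTop_atTop (R := ℝ) |>.eventually_gt_atTop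
    ((C₀ + C₁) / (r / 2))] with T hT
  filter_upwards [ae_all_iff.2 hmodel.update] with ω hω hbad
  obtain ⟨θ, hθ, hle⟩ := hbad
  refine Or.inl ?_
  by_contra hgood
  replace hgood := not_lt.1 hgood
  have h1 := abs_le.1 (hC₁ θ hθ (fun t => y t ω) (init T ω) (fun _ _ => 0) T)
  have h2 := abs_le.1 (hC₀ θ₀ ⟨mem_of_mem_nhds hU₀, hθ₀⟩ (fun t => y t ω) (init T ω)
    (fun k => p (-(k : ℤ)) ω) T)
  have h3 : logLikelihood (g θ₀) (fun t => y t ω) (fun k => p (-(k : ℤ)) ω) T =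
      ∑ t ∈ Finset.range T, logScore (y ((t : ℤ) + 1) ω) (p ((t : ℤ) + 1) ω) := by
    rw [logLikelihood_eq]
    refine Finset.sum_congr rfl fun t _ => ?_
    rw [fittedNext_of_solution (x := fun t => p t ω) hω]
  rw [div_lt_iff₀ (by positivity)] at hT
  linarith [h1.1, h1.2, h2.1, h2.2]

end GAB

theorem mainTheorem6 {Ω : Type*} [MeasurableSpace Ω] (μ : Measure Ω) [IsProbabilityMeasure μ]
    (N s q m : ℕ)
    (g : EuclideanSpace ℝ (Fin m) → GAB.UpdateMap N s q)
    (Θ : Set (EuclideanSpace ℝ (Fin m))) (θ₀ : EuclideanSpace ℝ (Fin m))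
    (y : ℤ → Ω → Fin N → Bool) (p : ℤ → Ω → Fin N → unitInterval)
    -- the data follow the model with parameter `θ₀`
    (hmodel : GAB.IsProcess μ (g θ₀) y p)
    -- compact parameter set containing the true parameter
    (hΘ : IsCompact Θ) (hθ₀ : θ₀ ∈ Θ)
    -- continuity
    (hcont : ContinuousOn
      (fun z : ((Fin s → Fin N → unitInterval) × (Fin q → Fin N → Bool)) ×
        EuclideanSpace ℝ (Fin m) => g z.2 z.1.1 z.1.2) (Set.univ ×ˢ Θ))
    -- probabilities bounded away from zero and one
    (hbdd : ∃ ε : ℝ, 0 < ε ∧ ∀ θ ∈ Θ, ∀ P Y i, (g θ P Y i : ℝ) ∈ Set.Icc ε (1 - ε))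
    -- identification
    (hident : ∀ θ ∈ Θ,
      (∀ t : ℤ, ∀ᵐ ω ∂μ,
        g θ (fun k => p (t - 1 - (k : ℤ)) ω) (fun k => y (t - 1 - (k : ℤ)) ω) =
          g θ₀ (fun k => p (t - 1 - (k : ℤ)) ω) (fun k => y (t - 1 - (k : ℤ)) ω)) → θ = θ₀)
    -- contraction
    (hcontr : (∀ θ ∈ Θ, GAB.CompanionContraction (g θ)) ∨
      (∀ θ ∈ Θ, GAB.AggregateContraction (g θ)))
    -- initial values of the probabilities used in the likelihood of sample size `T`
    (init : ℕ → Ω → Fin s → Fin N → unitInterval)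
    -- maximum likelihood estimator
    (θhat : ℕ → Ω → EuclideanSpace ℝ (Fin m))
    (hmem : ∀ T, ∀ᵐ ω ∂μ, θhat T ω ∈ Θ)
    (hmax : ∀ T, ∀ᵐ ω ∂μ, IsMaxOn
      (fun θ => GAB.logLikelihood (g θ) (fun t => y t ω) (init T ω) T) Θ (θhat T ω)) :
    TendstoInMeasure μ θhat atTop (fun _ => θ₀) := by
  obtain ⟨ε, hε, hbdd⟩ := hbdd
  have hc : ∀ θ ∈ Θ, GAB.IsContraction (g θ) := fun θ hθ =>
    hcontr.elim (fun H => (H θ hθ).isContraction) fun H => (H θ hθ).isContraction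
  intro r hr
  have hK : IsCompact (Θ \ Metric.eball θ₀ r) := hΘ.diff Metric.isOpen_eball
  have hloc : ∀ θ₁ ∈ Θ \ Metric.eball θ₀ r, ∃ U ∈ 𝓝 θ₁, Tendsto (fun T : ℕ => μ {ω | ∃ θ ∈ U ∩ Θ,
      GAB.logLikelihood (g θ₀) (fun t => y t ω) (init T ω) T ≤
        GAB.logLikelihood (g θ) (fun t => y t ω) (init T ω) T}) atTop (𝓝 0) := by
    intro θ₁ hθ₁
    have hne : θ₁ ≠ θ₀ := fun h => hθ₁.2 (h ▸ Metric.mem_eball_self hr)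
    obtain ⟨t, ht⟩ := not_forall.1 fun H => hne (hident θ₁ hθ₁.1 H)
    exact GAB.exists_nhds_tendsto_measure_logLikelihood_le hmodel hθ₀ hcont hε hbdd hc hθ₁.1 ht init
  choose! U hU hlim using hloc
  obtain ⟨I, hI, hcover⟩ := hK.elim_nhds_subcover U hU
  refine GAB.tendsto_measure_zero_of_ae_imp_exists I (fun θ₁ hθ₁ => hlim θ₁ (hI θ₁ hθ₁))
    (Eventually.of_forall fun T => ?_)
  filter_upwards [hmem T, hmax T] with ω h1 h2 hω
  have h3 : θhat T ω ∈ Θ \ Metric.eball θ₀ r := ⟨h1, fun h => not_lt.2 hω (Metric.mem_eball.1 h)⟩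
  obtain ⟨θ₁, hθ₁, h4⟩ := Set.mem_iUnion₂.1 (hcover h3)
  -- By maximality the likelihood at the estimator is at least that at θ₀, so the estimator itself
  -- witnesses the unlikely event.
  exact ⟨θ₁, hθ₁, θhat T ω, ⟨h4, h1⟩, h2 hθ₀⟩
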